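/- Let $l\ge 3$, $U\subseteq\mathbb R^2$ open, and let $\triangle=\partial_x^2+\partial_y^2=\partial_z\partial_{\bar z}$ where $z=(x+iy)/2$, i.e. $\partial_z=\partial_x-i\partial_y$, $\partial_{\bar z}=\partial_x+i\partial_y$. The two dimensional elliptic $B_l^{(1)}$ Toda equation for real $C^2$ functions $u_1,\dots,u_l$ on $U$ is $$\triangle u_1=e^{u_2+u_1}-e^{u_2-u_1},\qquad \triangle u_2=e^{u_2+u_1}+e^{u_2-u_1}-e^{u_3-u_2},$$ $$\triangle u_j=e^{u_j-u_{j-1}}-e^{u_{j+1}-u_j}\ (3\le j\le l-1),\qquad \triangle u_l=e^{u_l-u_{l-1}}-e^{-u_l}.$$ Vectors in $\mathbb C^{2l+1}$ are written in blocks $h=(h_1,\dots,h_{2l})^T$, with $h_1=(h_{11},h_{12})^T$ of size 2 and the other $h_j$ scalar; block subscripts are taken modulo $2l$, and $\{k\}\in\{0,\dots,2l-1\}$ is the remainder of $k$ modulo $2l$. Let $J$ be the matrix all of whose entries in the blocks $J_{j,j+1}$ ($j$ modulo $2l$) are $1$ and whose other entries are $0$, and let $V$ be the diagonal matrix with blocks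 $V_{11}=\mathrm{diag}(e^{u_1},e^{-u_1})$, $V_{jj}=e^{u_j}$ and $V_{2l+2-j,2l+2-j}=e^{-u_j}$ for $2\le j\le l$, $V_{l+1,l+1}=1$. The corresponding Lax pair with spectral parameter $\mu$ is $$h_z=(\mu J+V_zV^{-1})h,\qquad h_{\bar z}=\mu^{-1}VJ^TV^{-1}h .$$ Let $(u_1,\dots,u_l)$ be a solution of the Toda equation on $U$, let $\mu\in\mathbb C$ with $\mu\neq0$, $|\mu|\ne1$, and let $h$ be a (real-differentiable, complex valued) solution on $U$ of the Lax pair with parameter $\mu$ such that $$2h_{11}h_{12}+(-1)^l h_{l+1}^2+2\sum_{c=2}^{l}(-1)^{c-1}h_ch_{2-c}=0\quad\text{on }U.$$ Put $$\gamma_j=\frac1{1-|\mu|^{4l}}\Big((-|\mu|^2)^{\{j-1\}}(|h_{11}|^2e^{-u_1}+|h_{12}|^2e^{u_1})+(-|\mu|^2)^{\{j+l-1\}}|h_{l+1}|^2+\sum_{c=2}^l(-|\mu|^2)^{\{j+c-2\}}|h_c|^2e^{-u_c}+\sum_{c=2}^l(-|\mu|^2)^{\{j-c\}}|h_{2-c}|^2e^{u_c}\Big),$$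 $$g_j=\frac1{4l^2}\Big|2\{1-j\}h_{11}h_{12}+\sum_{c=2}^{2l}(-1)^{c+1}\{c-j\}h_{2-c}h_c\Big|^2-|\mu|^2\gamma_{j-1}\gamma_{2-j}.$$ Suppose that at every point of $U$ the quotients $$\frac{|h_{11}|^2e^{-u_1}-\gamma_1}{|h_{12}|^2e^{u_1}-\gamma_1}\quad\text{and}\quad \frac{g_{j+1}}{g_j}\ (2\le j\le l)$$ have non-zero denominators and are positive. Then $$\tilde u_1=u_1+\ln\frac{|h_{11}|^2e^{-u_1}-\gamma_1}{|h_{12}|^2e^{u_1}-\gamma_1},\qquad \tilde u_j=u_j+\ln\frac{g_{j+1}}{g_j}\quad(2\le j\le l)$$ is again a ($C^2$) solution of the two dimensional elliptic $B_l^{(1)}$ Toda equation on $U$. -/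

import Mathlib

/-!
The plane `ℝ²` is identified with `ℂ` by `(x, y) ↦ x + i y`.  The complex coordinate of the theory is
`z = (x + i y) / 2`, hence `∂_z = ∂_x - i ∂_y`, `∂_z̄ = ∂_x + i ∂_y`, and the Laplacian
`∂_x² + ∂_y²` is `∂_z ∂_z̄`.
-/

namespace EllipticToda

open Matrix

/-- `∂_z = ∂_x - i ∂_y` (for the coordinate `z = (x + i y) / 2`). -/
noncomputable def dz (f : ℂ → ℂ) (w : ℂ) : ℂ :=
  fderiv ℝ f w 1 - Complex.I * fderiv ℝ f w Complex.I

/-- `∂_z̄ = ∂_x + i ∂_y` (for the coordinate `z = (x + i y) / 2`). -/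
noncomputable def dzbar (f : ℂ → ℂ) (w : ℂ) : ℂ :=
  fderiv ℝ f w 1 + Complex.I * fderiv ℝ f w Complex.I

/-- Classical solutions `(u_1, …, u_l)` on `U` of the two dimensional elliptic `B_l^{(1)}` Toda
equation (`l ≥ 3`).  Only the functions `u j` with `1 ≤ j ≤ l` are used. -/
structure IsTodaSolution (l : ℕ) (U : Set ℂ) (u : ℕ → ℂ → ℝ) : Prop where
  contDiffOn : ∀ j, 1 ≤ j → j ≤ l → ContDiffOn ℝ 2 (u j) U
  eq_one : ∀ w ∈ U, Laplacian.laplacian (u 1) w =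
    Real.exp (u 2 w + u 1 w) - Real.exp (u 2 w - u 1 w)
  eq_two : ∀ w ∈ U, Laplacian.laplacian (u 2) w =
    Real.exp (u 2 w + u 1 w) + Real.exp (u 2 w - u 1 w) - Real.exp (u 3 w - u 2 w)
  eq_mid : ∀ j, 3 ≤ j → j + 1 ≤ l → ∀ w ∈ U, Laplacian.laplacian (u j) w =
    Real.exp (u j w - u (j - 1) w) - Real.exp (u (j + 1) w - u j w)
  eq_last : ∀ w ∈ U, Laplacian.laplacian (u l) w =
    Real.exp (u l w - u (l - 1) w) - Real.exp (-u l w)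

/-- Index set of the `(2l+1)`-dimensional vectors and matrices, divided into `N = 2l` blocks numbered
modulo `2l`.  Block `1` has size `2`, with entries `some 1` (first) and `none` (second); every other
block `j` has size `1`, with entry `some j`.  So for `v : Index l → ℂ` the components are
`v_{11} = v (some 1)`, `v_{12} = v none` and `v_j = v (some j)` for `j ≢ 1` mod `2l`. -/
abbrev Index (l : ℕ) : Type := Option (ZMod (2 * l))

/-- The number (modulo `2l`) of the block to which an index belongs. -/
def block {l : ℕ} : Index l → ZMod (2 * l)
  | some j => j
  | none => 1

/-- The matrix `J`: all entries of the blocks `J_{j,j+1}` are `1`, all the other entries are `0`. -/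
def J (l : ℕ) : Matrix (Index l) (Index l) ℂ :=
  Matrix.of fun a b => if block b = block a + 1 then 1 else 0

/-- Logarithms of the diagonal entries of `V`, where `V_{11} = diag(e^{u_1}, e^{-u_1})`,
`V_{jj} = e^{u_j}` and `V_{2l+2-j,2l+2-j} = e^{-u_j}` for `2 ≤ j ≤ l`, and `V_{l+1,l+1} = 1`.
The block `2l ≡ 0` has representative `0`. -/
def logV (l : ℕ) (u : ℕ → ℂ → ℝ) : Index l → ℂ → ℝ
  | none, w => -u 1 w
  | some j, w =>
      if j.val = 0 then -u 2 w
      else if j.val ≤ l then u j.val w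
      else if j.val = l + 1 then 0
      else -u (2 * l + 2 - j.val) w

/-- The real diagonal matrix `V`. -/
noncomputable def V (l : ℕ) (u : ℕ → ℂ → ℝ) (w : ℂ) : Matrix (Index l) (Index l) ℂ :=
  Matrix.diagonal fun a => ((Real.exp (logV l u a w) : ℝ) : ℂ)

/-- `P = V_z V⁻¹`. -/
noncomputable def P (l : ℕ) [NeZero l] (u : ℕ → ℂ → ℝ) (w : ℂ) : Matrix (Index l) (Index l) ℂ :=
  (Matrix.of fun a b => dz (fun p => V l u p a b) w) * (V l u w)⁻¹

/-- `Q = V Jᵀ V⁻¹`. -/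
noncomputable def Q (l : ℕ) [NeZero l] (u : ℕ → ℂ → ℝ) (w : ℂ) : Matrix (Index l) (Index l) ℂ :=
  V l u w * (J l)ᵀ * (V l u w)⁻¹

/-- Column solutions on `U` of the Lax pair `Φ_z = (λ J + P) Φ`, `Φ_z̄ = λ⁻¹ Q Φ` with `λ = μ`. -/
structure IsLaxSolution (l : ℕ) [NeZero l] (U : Set ℂ) (u : ℕ → ℂ → ℝ) (μ : ℂ)
    (h : ℂ → Index l → ℂ) : Prop where
  differentiableOn : DifferentiableOn ℝ h U
  eq_z : ∀ w ∈ U, (fun a => dz (fun p => h p a) w) = (μ • J l + P l u w) *ᵥ h w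
  eq_zbar : ∀ w ∈ U, (fun a => dzbar (fun p => h p a) w) = (μ⁻¹ • Q l u w) *ᵥ h w

/-- The functions `γ_j` (`j` modulo `2l`); `{k}`, the remainder of `k` modulo `2l`, is
`ZMod.val k`. -/
noncomputable def gam (l : ℕ) (μ : ℂ) (u : ℕ → ℂ → ℝ) (h : ℂ → Index l → ℂ)
    (j : ZMod (2 * l)) (w : ℂ) : ℝ :=
  1 / (1 - ‖μ‖ ^ (4 * l)) *
    ((-‖μ‖ ^ 2) ^ (j - 1).val *
        (‖h w (some 1)‖ ^ 2 * Real.exp (-u 1 w) + ‖h w none‖ ^ 2 * Real.exp (u 1 w))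
      + (-‖μ‖ ^ 2) ^ (j + (l : ZMod (2 * l)) - 1).val *
          ‖h w (some ((l : ZMod (2 * l)) + 1))‖ ^ 2
      + ∑ c ∈ Finset.Icc 2 l, (-‖μ‖ ^ 2) ^ (j + (c : ZMod (2 * l)) - 2).val *
          ‖h w (some (c : ZMod (2 * l)))‖ ^ 2 * Real.exp (-u c w)
      + ∑ c ∈ Finset.Icc 2 l, (-‖μ‖ ^ 2) ^ (j - (c : ZMod (2 * l))).val *
          ‖h w (some (2 - (c : ZMod (2 * l))))‖ ^ 2 * Real.exp (u c w))

/-- The functions `g_j` (`j` modulo `2l`). -/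
noncomputable def g (l : ℕ) (μ : ℂ) (u : ℕ → ℂ → ℝ) (h : ℂ → Index l → ℂ)
    (j : ZMod (2 * l)) (w : ℂ) : ℝ :=
  1 / (4 * (l : ℝ) ^ 2) *
      ‖2 * ((1 - j).val : ℂ) * h w (some 1) * h w none
        + ∑ c ∈ Finset.Icc 2 (2 * l), (-1 : ℂ) ^ (c + 1) * (((c : ZMod (2 * l)) - j).val : ℂ) *
            h w (some (2 - (c : ZMod (2 * l)))) * h w (some (c : ZMod (2 * l)))‖ ^ 2
    - ‖μ‖ ^ 2 * gam l μ u h (j - 1) w * gam l μ u h (2 - j) w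

/-- The factors `e^{ũ_j - u_j}`, `1 ≤ j ≤ l`, of the Darboux transformation. -/
noncomputable def factor (l : ℕ) (μ : ℂ) (u : ℕ → ℂ → ℝ) (h : ℂ → Index l → ℂ)
    (j : ℕ) (w : ℂ) : ℝ :=
  if j = 1 then
    (‖h w (some 1)‖ ^ 2 * Real.exp (-u 1 w) - gam l μ u h 1 w) /
      (‖h w none‖ ^ 2 * Real.exp (u 1 w) - gam l μ u h 1 w)
  else g l μ u h ((j : ZMod (2 * l)) + 1) w / g l μ u h (j : ZMod (2 * l)) w

/-- The transformed functions `ũ_j`. -/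
noncomputable def newU (l : ℕ) (μ : ℂ) (u : ℕ → ℂ → ℝ) (h : ℂ → Index l → ℂ)
    (j : ℕ) (w : ℂ) : ℝ :=
  u j w + Real.log (factor l μ u h j w)

end EllipticToda

namespace EllipticToda

open Matrix

/-! The new solution is governed by functions on the cycle of blocks modulo $2l$. In the Lax pair,
$\partial_z$ couples a block to its successor and $\partial_{\bar z}$ to its predecessor, while the
reflection $c\mapsto 2-c$ inverts the diagonal entries of $V$ outside block 1 (inside block 1 the
two entries are mutually inverse). Two families of quadratic expressions in $h$ therefore have
derivatives that are cyclic combinations of simple products. The Hermitian densities $D_b$ satisfy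
$D_b=\Gamma_b+|\mu|^2\Gamma_{b+1}$, where $\Gamma_b=\gamma_{2-b}$ (`gram`) is found by inverting
this recurrence, possible since $|\mu|^{4l}\ne1$. The pairings $p_j$ satisfy $p_j=a_{j+1}-a_j$
(`potential`); on a cycle this requires $\sum_j p_j=0$, which is the quadratic constraint. Both
$\partial_z\Gamma_b$ and $\partial_z a_j$ are single products of block sums.

The function $g_j$ is $\tau_j=|a_j|^2-|\mu|^2\Gamma_j\Gamma_{3-j}$. Away from the block of size 2 it
obeys a Hirota-type equation (`tau_bilinear`), equivalent for $3\le j\le l$ to $\triangle\ln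
g_j=e^{u_j-u_{j-1}}(1-g_{j+1}g_{j-1}/g_j^2)$; for $j=l+1$ the exponent is $-u_l$. At the block of
size 2, $g_2$ factors as $AB$ (`tau_two`), with $A=|h_{11}|^2e^{-u_1}-\gamma_1$ and
$B=|h_{12}|^2e^{u_1}-\gamma_1$, and each factor has its own equation, $\triangle\ln
A=e^{u_2-u_1}(1-g_3/A^2)$ and the same for $B$ with $-u_1$ in place of $u_1$ (`edge_bilinear`). At
the other end $a_{3-j}=-a_j$ gives $g_{l+2}=g_{l+1}$.

Since $\tilde u_1=u_1+\ln(A/B)$ and $\tilde u_j=u_j+\ln(g_{j+1}/g_j)$, subtracting these formulas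
cancels the old exponentials and leaves those of the new functions. -/

/-! ### Wirtinger calculus for the coordinate $z=(x+iy)/2$ -/

/-- The real linear map `v ↦ (p v + q v̄) / 2`. -/
noncomputable def wirtingerCLM (p q : ℂ) : ℂ →L[ℝ] ℂ :=
  (p / 2) • ContinuousLinearMap.id ℝ ℂ + (q / 2) • (Complex.conjCLE : ℂ →L[ℝ] ℂ)

@[simp] lemma wirtingerCLM_apply (p q v : ℂ) :
    wirtingerCLM p q v = p / 2 * v + q / 2 * (starRingEnd ℂ) v := by
  simp [wirtingerCLM]

/-- `f` is real differentiable at `w` with `∂_z f = p` and `∂_z̄ f = q`. -/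
def HasWirtinger (f : ℂ → ℂ) (p q w : ℂ) : Prop := HasFDerivAt f (wirtingerCLM p q) w

namespace HasWirtinger

variable {f f' : ℂ → ℂ} {p q p' q' w : ℂ}

lemma dz_eq (hf : HasWirtinger f p q w) : dz f w = p := by
  unfold dz
  rw [HasFDerivAt.fderiv hf]
  simp only [wirtingerCLM_apply, map_one, Complex.conj_I]
  linear_combination (-p / 2 + q / 2) * Complex.I_mul_I

lemma dzbar_eq (hf : HasWirtinger f p q w) : dzbar f w = q := by
  unfold dzbar
  rw [HasFDerivAt.fderiv hf]
  simp only [wirtingerCLM_apply, map_one, Complex.conj_I]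
  linear_combination (p / 2 - q / 2) * Complex.I_mul_I

lemma of_differentiableAt (hf : DifferentiableAt ℝ f w) :
    HasWirtinger f (dz f w) (dzbar f w) w := by
  have h := hf.hasFDerivAt
  unfold HasWirtinger
  convert h using 1
  refine ContinuousLinearMap.ext fun v => ?_
  have hv : v = v.re • (1 : ℂ) + v.im • Complex.I := by simp
  have e : fderiv ℝ f w v = v.re • fderiv ℝ f w 1 + v.im • fderiv ℝ f w Complex.I := by
    conv_lhs => rw [hv]
    rw [map_add, map_smul, map_smul]
  rw [e, wirtingerCLM_apply, dz, dzbar]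
  have h1 : (starRingEnd ℂ) v = v.re - v.im * Complex.I := by
    apply Complex.ext <;> simp
  have h2 : v = v.re + v.im * Complex.I := by simp
  rw [h1]
  nth_rw 1 [h2]
  simp only [Complex.real_smul]
  linear_combination (-(fderiv ℝ f w Complex.I) * v.im) * Complex.I_mul_I

lemma of_hasFDerivAt {T : ℂ →L[ℝ] ℂ} (hf : HasFDerivAt f T w)
    (hT : ∀ v, T v = p / 2 * v + q / 2 * (starRingEnd ℂ) v) : HasWirtinger f p q w := by
  have : T = wirtingerCLM p q := ContinuousLinearMap.ext fun v => by simp [hT]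
  rwa [HasWirtinger, ← this]

lemma congr_deriv (hf : HasWirtinger f p q w) (hp : p = p') (hq : q = q') :
    HasWirtinger f p' q' w := by subst hp hq; exact hf

lemma congr_of_eventuallyEq (hf : HasWirtinger f p q w)
    (h : ∀ᶠ x in nhds w, f' x = f x) : HasWirtinger f' p q w :=
  HasFDerivAt.congr_of_eventuallyEq hf h

lemma const (c : ℂ) : HasWirtinger (fun _ => c) 0 0 w := by
  refine of_hasFDerivAt (hasFDerivAt_const c w) fun v => ?_
  simp

lemma add (hf : HasWirtinger f p q w) (hf' : HasWirtinger f' p' q' w) :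
    HasWirtinger (fun x => f x + f' x) (p + p') (q + q') w := by
  refine of_hasFDerivAt (HasFDerivAt.add hf hf') fun v => ?_
  simp; ring

lemma mul (hf : HasWirtinger f p q w) (hf' : HasWirtinger f' p' q' w) :
    HasWirtinger (fun x => f x * f' x) (p * f' w + f w * p') (q * f' w + f w * q') w := by
  refine of_hasFDerivAt (HasFDerivAt.mul hf hf') fun v => ?_
  simp; ring

lemma const_mul (c : ℂ) (hf : HasWirtinger f p q w) :
    HasWirtinger (fun x => c * f x) (c * p) (c * q) w :=
  ((const c).mul hf).congr_deriv (by ring) (by ring)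

lemma sub (hf : HasWirtinger f p q w) (hf' : HasWirtinger f' p' q' w) :
    HasWirtinger (fun x => f x - f' x) (p - p') (q - q') w := by
  have := hf.add (hf'.const_mul (-1))
  exact (this.congr_deriv (by ring) (by ring)).congr_of_eventuallyEq
    (Filter.Eventually.of_forall fun x => by ring)

lemma sum {ι : Type*} (s : Finset ι) {f : ι → ℂ → ℂ} {p q : ι → ℂ}
    (hf : ∀ i ∈ s, HasWirtinger (f i) (p i) (q i) w) :
    HasWirtinger (fun x => ∑ i ∈ s, f i x) (∑ i ∈ s, p i) (∑ i ∈ s, q i) w := by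
  refine of_hasFDerivAt (HasFDerivAt.fun_sum hf) fun v => ?_
  simp [Finset.sum_add_distrib, Finset.sum_div, Finset.sum_mul]

lemma star (hf : HasWirtinger f p q w) :
    HasWirtinger (fun x => (starRingEnd ℂ) (f x)) ((starRingEnd ℂ) q) ((starRingEnd ℂ) p) w := by
  refine of_hasFDerivAt ((Complex.conjCLE : ℂ →L[ℝ] ℂ).hasFDerivAt.comp w hf) fun v => ?_
  simp [show (starRingEnd ℂ) 2 = 2 from map_ofNat _ 2]; ring

lemma cexp (hf : HasWirtinger f p q w) :
    HasWirtinger (fun x => Complex.exp (f x)) (Complex.exp (f w) * p) (Complex.exp (f w) * q) w := by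
  refine of_hasFDerivAt (HasFDerivAt.cexp hf) fun v => ?_
  simp; ring

lemma differentiableAt (hf : HasWirtinger f p q w) : DifferentiableAt ℝ f w :=
  HasFDerivAt.differentiableAt hf

/-- Conjugation exchanges the two derivatives and fixes a real function. -/
lemma conj_dz_ofReal {v : ℂ → ℝ} (hf : HasWirtinger (fun x => (v x : ℂ)) p q w) :
    (starRingEnd ℂ) p = q := by
  have := hf.star.dzbar_eq
  simp only [Complex.conj_ofReal] at this
  rw [← this, hf.dzbar_eq]

lemma log_ofReal {v : ℂ → ℝ} (hf : HasWirtinger (fun x => (v x : ℂ)) p q w) (h0 : v w ≠ 0) :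
    HasWirtinger (fun x => (Real.log (v x) : ℂ)) (p / v w) (q / v w) w := by
  have hv : HasFDerivAt v (Complex.reCLM.comp (wirtingerCLM p q)) w := by
    have := Complex.reCLM.hasFDerivAt.comp w hf
    simpa [Function.comp_def] using this
  -- By uniqueness of the derivative, the differential of a real function takes real values, so
  -- passing to the real part loses nothing.
  have hv' : Complex.ofRealCLM.comp (Complex.reCLM.comp (wirtingerCLM p q)) = wirtingerCLM p q :=
    (Complex.ofRealCLM.hasFDerivAt.comp w hv).unique hf
  have := Complex.ofRealCLM.hasFDerivAt.comp w (hv.log h0)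
  refine of_hasFDerivAt this fun x => ?_
  have e := congrArg (fun T => T x) hv'
  simp only [ContinuousLinearMap.comp_apply, Complex.ofRealCLM_apply, Complex.reCLM_apply,
    wirtingerCLM_apply] at e
  simp only [ContinuousLinearMap.comp_apply, Complex.ofRealCLM_apply, Complex.reCLM_apply,
    wirtingerCLM_apply, _root_.smul_apply, smul_eq_mul, Complex.ofReal_mul, e,
    Complex.ofReal_inv]
  ring

end HasWirtinger

/-! ### Regularity and the Laplacian through Wirtinger derivatives -/

lemma contDiffOn_ofReal {n : WithTop ℕ∞} {U : Set ℂ} {f : ℂ → ℝ} (hf : ContDiffOn ℝ n f U) :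
    ContDiffOn ℝ n (fun x => (f x : ℂ)) U :=
  Complex.ofRealCLM.contDiff.comp_contDiffOn hf

lemma contDiffOn_conj {n : WithTop ℕ∞} {U : Set ℂ} {f : ℂ → ℂ} (hf : ContDiffOn ℝ n f U) :
    ContDiffOn ℝ n (fun x => (starRingEnd ℂ) (f x)) U :=
  Complex.conjCLE.contDiff.comp_contDiffOn hf

lemma contDiffOn_dz {U : Set ℂ} (hU : IsOpen U) {f : ℂ → ℂ} (hf : ContDiffOn ℝ 2 f U) :
    ContDiffOn ℝ 1 (dz f) U := by
  have h : ContDiffOn ℝ 1 (fderiv ℝ f) U := hf.fderiv_of_isOpen hU (by norm_num)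
  exact (h.clm_apply contDiffOn_const).sub
    (contDiffOn_const.mul (h.clm_apply contDiffOn_const))

lemma contDiffOn_succ_of_hasWirtinger {n : ℕ} {U : Set ℂ} (hU : IsOpen U) {f p q : ℂ → ℂ}
    (hf : ∀ w ∈ U, HasWirtinger f (p w) (q w) w)
    (hp : ContDiffOn ℝ n p U) (hq : ContDiffOn ℝ n q U) : ContDiffOn ℝ (n + 1) f U := by
  rw [contDiffOn_succ_iff_fderiv_of_isOpen hU]
  refine ⟨fun w hw => (hf w hw).differentiableAt.differentiableWithinAt, by simp, ?_⟩
  have : ContDiffOn ℝ n (fun w => wirtingerCLM (p w) (q w)) U := by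
    unfold wirtingerCLM
    exact ((hp.div_const 2).smul contDiffOn_const).add ((hq.div_const 2).smul contDiffOn_const)
  exact this.congr fun w hw => HasFDerivAt.fderiv (hf w hw)

/-- The Laplacian is `∂_z̄ ∂_z`. -/
lemma laplacian_eq_of_hasWirtinger {U : Set ℂ} (hU : IsOpen U) {f : ℂ → ℝ} {p q : ℂ → ℂ}
    {r s w : ℂ} (hw : w ∈ U) (hf2 : ContDiffOn ℝ 2 f U)
    (hf : ∀ x ∈ U, HasWirtinger (fun y => (f y : ℂ)) (p x) (q x) x)
    (hp : HasWirtinger p r s w) : ((Laplacian.laplacian f w : ℝ) : ℂ) = s := by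
  have hfw : ContDiffAt ℝ 2 f w := hf2.contDiffAt (hU.mem_nhds hw)
  have hd : DifferentiableAt ℝ (fderiv ℝ f) w :=
    ((hf2.fderiv_of_isOpen hU (m := 1) (by norm_num)).contDiffAt (hU.mem_nhds hw)).differentiableAt
      (by norm_num)
  have hp' : ∀ᶠ x in nhds w,
      p x = (fderiv ℝ f x 1 : ℂ) - Complex.I * (fderiv ℝ f x Complex.I : ℂ) := by
    filter_upwards [hU.mem_nhds hw] with x hx
    rw [← (hf x hx).dz_eq]
    have hfx : DifferentiableAt ℝ f x :=
      (hf2.contDiffAt (hU.mem_nhds hx)).differentiableAt (by norm_num)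
    have := (Complex.ofRealCLM.hasFDerivAt.comp x hfx.hasFDerivAt).fderiv
    have e : fderiv ℝ (fun y => (f y : ℂ)) x = Complex.ofRealCLM.comp (fderiv ℝ f x) := this
    simp [dz, e]
  have h1 : ∀ v : ℂ, HasFDerivAt (fun x => (fderiv ℝ f x v : ℂ))
      (Complex.ofRealCLM.comp ((fderiv ℝ (fderiv ℝ f) w).flip v)) w := by
    intro v
    have := hd.hasFDerivAt.clm_apply (hasFDerivAt_const v w)
    have := Complex.ofRealCLM.hasFDerivAt.comp w this
    simpa [Function.comp_def] using this
  have h2 := ((h1 1).sub ((h1 Complex.I).const_mul Complex.I)).congr_of_eventuallyEq hp'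
  have h3 := h2.unique hp
  have e1 := congrArg (fun T => T 1) h3
  have e2 := congrArg (fun T => T Complex.I) h3
  -- Symmetry of the second derivative removes the cross terms
  -- $i(\partial_y\partial_x-\partial_x\partial_y)$ of $\partial_{\bar z}\partial_z$.
  have hsymm : IsSymmSndFDerivAt ℝ f w := hfw.isSymmSndFDerivAt (by simp)
  have e3 := hsymm.eq 1 Complex.I
  simp at e1 e2
  rw [InnerProductSpace.laplacian_eq_iteratedFDeriv_complexPlane]
  simp only [iteratedFDeriv_two_apply]
  simp
  rw [e3] at e1
  linear_combination e1 + Complex.I * e2 + (-s / 2 + r / 2 +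
    (fderiv ℝ (fderiv ℝ f) w Complex.I Complex.I : ℂ)) * Complex.I_mul_I

/-- `△ log |G|` through the derivatives of `G`. -/
lemma laplacian_log {U : Set ℂ} (hU : IsOpen U) {G : ℂ → ℝ} {p q : ℂ → ℂ}
    {r s w : ℂ} (hw : w ∈ U) (hG2 : ContDiffOn ℝ 2 G U) (hG0 : ∀ x ∈ U, G x ≠ 0)
    (hG : ∀ x ∈ U, HasWirtinger (fun y => (G y : ℂ)) (p x) (q x) x)
    (hp : HasWirtinger p r s w) :
    ((Laplacian.laplacian (fun x => Real.log (G x)) w : ℝ) : ℂ) =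
      (s * G w - p w * q w) / (G w : ℂ) ^ 2 := by
  have hG0' : (G w : ℂ) ≠ 0 := by exact_mod_cast hG0 w hw
  have hinv : HasWirtinger (fun x => ((G x : ℂ))⁻¹) (-(p w) / (G w : ℂ) ^ 2)
      (-(q w) / (G w : ℂ) ^ 2) w := by
    have := (hasDerivAt_inv hG0').hasFDerivAt.restrictScalars ℝ |>.comp w (hG w hw)
    refine .of_hasFDerivAt this fun v => ?_
    simp
    field_simp
    ring
  have := laplacian_eq_of_hasWirtinger hU hw (hG2.log hG0)
    (fun x hx => (hG x hx).log_ofReal (hG0 x hx)) (hp.mul hinv)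
  rw [this]
  field_simp
  ring

/-! ### Inverting cyclic recurrences and differences -/

/-- The weights of the cyclic recurrence `γ_b + m γ_{b+1} = H_b` summed up: `∑_c (-m)^{c-b} H_c`. -/
lemma sum_neg_pow_val {R : Type*} [CommRing R] (N : ℕ) [NeZero N] (hN : 2 ≤ N) (he : Even N) (m : R)
    (X : ZMod N → R) (b : ZMod N) :
    ∑ c, (-m) ^ (c - b).val * (X c + m * X (c + 1)) = (1 - m ^ N) * X b := by
  -- The exponent grows by one at each step except at the wrap-around $c=b$, where it drops from
  -- $N-1$ to $0$; there the mismatch is $1-(-m)^N=1-m^N$, as $N$ is even.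
  have key : ∀ c : ZMod N, (-m) ^ (c - b).val + m * (-m) ^ (c - b - 1).val =
      if c = b then 1 - m ^ N else 0 := by
    intro c
    have : Fact (1 < N) := ⟨hN⟩
    split_ifs with hc
    · subst hc
      have : (-1 : ZMod N).val = N - 1 := by
        rw [ZMod.neg_val, if_neg one_ne_zero, ZMod.val_one]
      rw [sub_self, zero_sub, this, ZMod.val_zero, pow_zero]
      have h2 : m * (-m) ^ (N - 1) = - (-m) ^ N := by
        conv_rhs => rw [← Nat.sub_add_cancel (show 1 ≤ N by omega), pow_succ]
        ring
      rw [h2, he.neg_pow]; ring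
    · have h0 : c - b ≠ 0 := sub_ne_zero.mpr hc
      have h1 : (c - b - 1).val + 1 = (c - b).val := by
        have : 1 ≤ (c - b).val := Nat.one_le_iff_ne_zero.mpr ((ZMod.val_ne_zero _).mpr h0)
        rw [ZMod.val_sub (by rwa [ZMod.val_one]), ZMod.val_one]; omega
      rw [← h1, pow_succ]; ring
  have h1 : ∑ c, (-m) ^ (c - b).val * X (c + 1) = ∑ c, (-m) ^ (c - b - 1).val * X c := by
    refine Fintype.sum_equiv (Equiv.addRight 1) _ _ fun c => ?_
    simp only [Equiv.coe_addRight]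
    congr 3; ring
  have h2 : ∑ c, (-m) ^ (c - b).val * (X c + m * X (c + 1)) =
      ∑ c, (-m) ^ (c - b).val * X c + m * ∑ c, (-m) ^ (c - b).val * X (c + 1) := by
    rw [Finset.mul_sum, ← Finset.sum_add_distrib]
    exact Finset.sum_congr rfl fun c _ => by ring
  rw [h2, h1, Finset.mul_sum, ← Finset.sum_add_distrib]
  have h3 : ∀ c, (-m) ^ (c - b).val * X c + m * ((-m) ^ (c - b - 1).val * X c) =
      if c = b then (1 - m ^ N) * X c else 0 := fun c => by
    have := key c
    split_ifs with hc
    · rw [if_pos hc] at this; linear_combination X c * this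
    · rw [if_neg hc] at this; linear_combination X c * this
  simp [h3]

/-- Summation by parts against a sawtooth: its increments are $1$ except for the jump $1-N$ at
$c=j$. When the sum of $X$ vanishes, the sawtooth thus inverts the cyclic difference up to the
factor $-N$. -/
lemma sum_val_mul_sub {R : Type*} [CommRing R] (N : ℕ) [NeZero N] (hN : 2 ≤ N)
    (X : ZMod N → R) (j : ZMod N) :
    ∑ c, ((c - j).val : R) * (X c - X (c + 1)) = ∑ c, X c - N * X j := by
  have : Fact (1 < N) := ⟨hN⟩
  have key : ∀ c : ZMod N, ((c - j).val : R) - ((c - j - 1).val : R) =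
      if c = j then 1 - (N : R) else 1 := by
    intro c
    split_ifs with hc
    · subst hc
      have : (-1 : ZMod N).val = N - 1 := by
        rw [ZMod.neg_val, if_neg one_ne_zero, ZMod.val_one]
      rw [sub_self, zero_sub, this, ZMod.val_zero, Nat.cast_sub (by omega)]
      push_cast; ring
    · have h0 : c - j ≠ 0 := sub_ne_zero.mpr hc
      have h1 : (c - j - 1).val + 1 = (c - j).val := by
        have : 1 ≤ (c - j).val := Nat.one_le_iff_ne_zero.mpr ((ZMod.val_ne_zero _).mpr h0)
        rw [ZMod.val_sub (by rwa [ZMod.val_one]), ZMod.val_one]; omega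
      rw [← h1]; push_cast; ring
  have h1 : ∑ c, ((c - j).val : R) * X (c + 1) = ∑ c, ((c - j - 1).val : R) * X c := by
    refine Fintype.sum_equiv (Equiv.addRight 1) _ _ fun c => ?_
    simp only [Equiv.coe_addRight]
    congr 3; ring
  have h2 : ∀ c, ((c - j).val : R) * X c - ((c - j - 1).val : R) * X c =
      X c - if c = j then N * X c else 0 := fun c => by
    have := key c
    split_ifs with hc
    · rw [if_pos hc] at this; linear_combination X c * this
    · rw [if_neg hc] at this; linear_combination X c * this
  simp_rw [mul_sub]
  rw [Finset.sum_sub_distrib, h1, ← Finset.sum_sub_distrib]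
  rw [Finset.sum_congr rfl fun c _ => h2 c]
  simp [Finset.sum_sub_distrib]

/-! ### Signs and sums over the blocks modulo $2l$ -/

/-- `(-1)^{j+1}` for `j` modulo `2l`. -/
def altSign {l : ℕ} (j : ZMod (2 * l)) : ℂ := (-1) ^ (j.val + 1)

/-- The modulus $2l$ is even, so the sign does not depend on the representative. -/
lemma altSign_natCast {l : ℕ} (c : ℕ) : altSign (c : ZMod (2 * l)) = (-1) ^ (c + 1) := by
  unfold altSign
  rw [ZMod.val_natCast, pow_succ, pow_succ]
  conv_rhs => rw [← Nat.mod_add_div c (2 * l), pow_add, mul_assoc 2 l, pow_mul]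
  simp

lemma altSign_mul_self {l : ℕ} (j : ZMod (2 * l)) : altSign j * altSign j = 1 := by
  unfold altSign; rw [← mul_pow]; simp

lemma altSign_one {l : ℕ} : altSign (1 : ZMod (2 * l)) = 1 := by
  rw [← Nat.cast_one, altSign_natCast]; norm_num

section
variable {l : ℕ} [NeZero l]

lemma altSign_add_one (j : ZMod (2 * l)) : altSign (j + 1) = -altSign j := by
  rw [← ZMod.natCast_zmod_val j, ← Nat.cast_one, ← Nat.cast_add, altSign_natCast, altSign_natCast]
  ring

lemma altSign_sub_one (j : ZMod (2 * l)) : altSign (j - 1) = -altSign j := by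
  rw [← neg_neg (altSign (j - 1)), ← altSign_add_one, sub_add_cancel]

lemma altSign_two_sub (j : ZMod (2 * l)) : altSign (2 - j) = altSign j := by
  have h : (2 - j : ZMod (2 * l)) = ((2 * l - j.val + 2 : ℕ) : ZMod (2 * l)) := by
    have : j.val ≤ 2 * l := (ZMod.val_lt j).le
    rw [Nat.cast_add, Nat.cast_sub this, ZMod.natCast_self, ZMod.natCast_zmod_val]
    push_cast; ring
  have hj : j.val ≤ 2 * l := (ZMod.val_lt j).le
  rw [h, altSign_natCast]
  unfold altSign
  have h2 : ((-1 : ℂ)) ^ (2 * l - j.val + 2 + 1) * (-1) ^ (j.val + 1) = 1 := by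
    rw [← pow_add, show 2 * l - j.val + 2 + 1 + (j.val + 1) = 2 * (l + 2) by omega, pow_mul]; simp
  have h3 : ((-1 : ℂ)) ^ (j.val + 1) * (-1) ^ (j.val + 1) = 1 := by
    rw [← mul_pow]; simp
  linear_combination (-1 : ℂ) ^ (j.val + 1) * h2 - (-1 : ℂ) ^ (2 * l - j.val + 2 + 1) * h3

/-- Sum over all residues as a sum over `1, …, 2l`. -/
lemma sum_zmod_eq_Icc {R : Type*} [AddCommMonoid R] (N : ℕ) [NeZero N] (f : ZMod N → R) :
    ∑ c, f c = ∑ c ∈ Finset.Icc 1 N, f (c : ZMod N) := by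
  symm
  have hN : 0 < N := Nat.pos_of_ne_zero (NeZero.ne N)
  refine Finset.sum_bij (fun c _ => (c : ZMod N)) (fun _ _ => Finset.mem_univ _) ?_ ?_
    (fun _ _ => rfl)
  · intro a ha b hb hab
    rw [Finset.mem_Icc] at ha hb
    rw [ZMod.natCast_eq_natCast_iff'] at hab
    rcases ha.2.lt_or_eq with h1 | h1 <;> rcases hb.2.lt_or_eq with h2 | h2
    · rwa [Nat.mod_eq_of_lt h1, Nat.mod_eq_of_lt h2] at hab
    · subst h2; rw [Nat.mod_eq_of_lt h1, Nat.mod_self] at hab; omega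
    · subst h1; rw [Nat.mod_eq_of_lt h2, Nat.mod_self] at hab; omega
    · omega
  · intro b _
    by_cases hb : b = 0
    · exact ⟨N, Finset.mem_Icc.mpr ⟨hN, le_rfl⟩, by simp [hb]⟩
    · exact ⟨b.val, Finset.mem_Icc.mpr ⟨Nat.one_le_iff_ne_zero.mpr ((ZMod.val_ne_zero _).mpr hb),
        (ZMod.val_lt b).le⟩, by simp⟩

/-- Sum over all blocks, first the block `1`, then by `c ≥ 2`. -/
lemma sum_zmod_eq_one_add (hl : 3 ≤ l) {R : Type*} [AddCommMonoid R] (f : ZMod (2 * l) → R) :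
    ∑ c, f c = f 1 + ∑ c ∈ Finset.Icc 2 (2 * l), f (c : ZMod (2 * l)) := by
  rw [sum_zmod_eq_Icc, ← Finset.add_sum_Ioc_eq_sum_Icc (by omega)]
  simp only [Nat.cast_one]
  rfl

/-- Sum over all blocks, arranged by the involution `c ↦ 2 - c`. -/
lemma sum_zmod_eq_split (hl : 3 ≤ l) {R : Type*} [AddCommMonoid R] (f : ZMod (2 * l) → R) :
    ∑ c, f c = f 1 + f ((l : ZMod (2 * l)) + 1) + ∑ c ∈ Finset.Icc 2 l, f (c : ZMod (2 * l))
      + ∑ c ∈ Finset.Icc 2 l, f (2 - (c : ZMod (2 * l))) := by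
  -- The residue $2-c$ is represented by $2l+2-c$, which runs through $l+2,\dots,2l$.
  have h1 : ∑ c ∈ Finset.Icc 2 l, f (2 - (c : ZMod (2 * l))) =
      ∑ c ∈ Finset.Icc (l + 2) (2 * l), f (c : ZMod (2 * l)) := by
    refine Finset.sum_bij' (fun c _ => 2 * l + 2 - c) (fun c _ => 2 * l + 2 - c) ?_ ?_ ?_ ?_ ?_
    · intro c hc; rw [Finset.mem_Icc] at *; omega
    · intro c hc; rw [Finset.mem_Icc] at *; omega
    · intro c hc; rw [Finset.mem_Icc] at *; omega
    · intro c hc; rw [Finset.mem_Icc] at *; omega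
    · intro c hc
      rw [Finset.mem_Icc] at hc
      rw [Nat.cast_sub (by omega), Nat.cast_add, ZMod.natCast_self, zero_add, Nat.cast_two]
  have h2 : Finset.Icc 2 (2 * l) =
      Finset.Icc 2 l ∪ ({l + 1} ∪ Finset.Icc (l + 2) (2 * l)) := by
    ext c; simp only [Finset.mem_Icc, Finset.mem_union, Finset.mem_singleton]; omega
  rw [sum_zmod_eq_one_add hl, h1, h2, Finset.sum_union, Finset.sum_union, Finset.sum_singleton]
  · push_cast; abel
  · rw [Finset.disjoint_singleton_left, Finset.mem_Icc]; omega
  · rw [Finset.disjoint_left]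
    intro c; simp only [Finset.mem_Icc, Finset.mem_union, Finset.mem_singleton]; omega

end

/-! ### The entries of $\ln V$ and their reflection symmetry -/

section
variable {l : ℕ}

lemma natCast_ne_natCast {a b : ℕ} (ha : a < 2 * l) (hb : b < 2 * l) (hab : a ≠ b) :
    (a : ZMod (2 * l)) ≠ b := by
  rw [Ne, ZMod.natCast_eq_natCast_iff', Nat.mod_eq_of_lt ha, Nat.mod_eq_of_lt hb]
  exact hab

variable (u : ℕ → ℂ → ℝ) (w : ℂ)

lemma logV_natCast {c : ℕ} (h1 : 1 ≤ c) (h2 : c ≤ l) :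
    logV l u (some (c : ZMod (2 * l))) w = u c w := by
  have hv : (c : ZMod (2 * l)).val = c := ZMod.val_cast_of_lt (by omega)
  unfold logV
  simp only [hv]
  rw [if_neg (by omega), if_pos h2]

lemma logV_some_one (hl : 3 ≤ l) : logV l u (some 1) w = u 1 w := by
  have := logV_natCast (l := l) u w (c := 1) le_rfl (by omega)
  rwa [Nat.cast_one] at this

lemma logV_add_one (hl : 3 ≤ l) : logV l u (some ((l : ZMod (2 * l)) + 1)) w = 0 := by
  have hv : ((l : ZMod (2 * l)) + 1).val = l + 1 := by
    rw [← Nat.cast_one, ← Nat.cast_add]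
    exact ZMod.val_cast_of_lt (by omega)
  unfold logV
  simp only [hv]
  rw [if_neg (by omega), if_neg (by omega)]
  simp

lemma logV_two_sub_natCast (hl : 3 ≤ l) {c : ℕ} (h1 : 2 ≤ c) (h2 : c ≤ l) :
    logV l u (some (2 - (c : ZMod (2 * l)))) w = -u c w := by
  rcases h1.eq_or_lt with rfl | h1
  · simp [logV]
  · have hv : (2 - (c : ZMod (2 * l))).val = 2 * l + 2 - c := by
      have : (2 - (c : ZMod (2 * l))) = ((2 * l + 2 - c : ℕ) : ZMod (2 * l)) := by
        rw [Nat.cast_sub (by omega), Nat.cast_add, ZMod.natCast_self]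
        simp
      rw [this]
      exact ZMod.val_cast_of_lt (by omega)
    unfold logV
    simp only [hv]
    rw [if_neg (by omega), if_neg (by omega), if_neg (by omega)]
    congr 2; omega

end

section
variable {l : ℕ} [NeZero l]

lemma block_cases (hl : 3 ≤ l) {b : ZMod (2 * l)} (hb : b ≠ 1) :
    (∃ c : ℕ, 2 ≤ c ∧ c ≤ l ∧ b = c) ∨ b = (l : ZMod (2 * l)) + 1 ∨
      ∃ c : ℕ, 2 ≤ c ∧ c ≤ l ∧ b = 2 - c := by
  have hv := ZMod.val_lt b
  have hb' : b = (b.val : ZMod (2 * l)) := by simp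
  have h1 : b.val ≠ 1 := fun h => hb (by rw [hb', h, Nat.cast_one])
  rcases Nat.eq_zero_or_pos b.val with h0 | h0
  · refine Or.inr (Or.inr ⟨2, le_rfl, by omega, ?_⟩)
    rw [hb', h0]; push_cast; ring
  · rcases le_or_gt b.val l with h2 | h2
    · exact Or.inl ⟨b.val, by omega, h2, hb'⟩
    · rcases eq_or_ne b.val (l + 1) with h3 | h3
      · refine Or.inr (Or.inl ?_)
        rw [hb', h3]; push_cast; ring
      · refine Or.inr (Or.inr ⟨2 * l + 2 - b.val, by omega, by omega, ?_⟩)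
        rw [Nat.cast_sub (by omega), Nat.cast_add, ZMod.natCast_self]
        simp

variable (u : ℕ → ℂ → ℝ) (w : ℂ)

/-- This antisymmetry underlies every relation between the indices $j$ and $3-j$ below. The block
$l+1$ is the fixed point of the reflection other than $1$, and its entry of $\ln V$ is $0$. -/
lemma logV_two_sub (hl : 3 ≤ l) {b : ZMod (2 * l)} (hb : b ≠ 1) :
    logV l u (some (2 - b)) w = -logV l u (some b) w := by
  rcases block_cases hl hb with ⟨c, h1, h2, rfl⟩ | rfl | ⟨c, h1, h2, rfl⟩
  · rw [logV_two_sub_natCast u w hl h1 h2, logV_natCast u w (by omega) h2]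
  · have : (2 - ((l : ZMod (2 * l)) + 1)) = (l : ZMod (2 * l)) + 1 := by
      have := ZMod.natCast_self (2 * l)
      push_cast at this
      linear_combination -this
    rw [this, logV_add_one u w hl, neg_zero]
  · rw [sub_sub_cancel, logV_two_sub_natCast u w hl h1 h2, logV_natCast u w (by omega) h2,
      neg_neg]

lemma contDiffOn_logV (hl : 3 ≤ l) {u : ℕ → ℂ → ℝ} {U : Set ℂ} (hu : IsTodaSolution l U u)
    (α : Index l) :
    ContDiffOn ℝ 2 (logV l u α) U := by
  match α with
  | none => exact (hu.contDiffOn 1 le_rfl (by omega)).neg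
  | some b =>
    by_cases hb : b = 1
    · subst hb
      exact (hu.contDiffOn 1 le_rfl (by omega)).congr fun w _ => logV_some_one u w hl
    rcases block_cases hl hb with ⟨c, h1, h2, rfl⟩ | rfl | ⟨c, h1, h2, rfl⟩
    · exact (hu.contDiffOn c (by omega) h2).congr fun w _ => logV_natCast u w (by omega) h2
    · exact contDiffOn_const.congr fun w _ => logV_add_one u w hl
    · exact (hu.contDiffOn c (by omega) h2).neg.congr fun w _ =>
        logV_two_sub_natCast u w hl h1 h2

end

/-! ### The Lax pair in components -/

section
variable {l : ℕ} (u : ℕ → ℂ → ℝ) (h : ℂ → Index l → ℂ)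

/-- `e^{-v_α}` for the diagonal entry `e^{v_α}` of `V`. -/
noncomputable def expNeg (l : ℕ) (u : ℕ → ℂ → ℝ) (α : Index l) (w : ℂ) : ℂ :=
  Complex.exp (-(logV l u α w : ℂ))

/-- The sum of the entries of the block `b` of `h`. -/
def blockSum (b : ZMod (2 * l)) (w : ℂ) : ℂ := h w (some b) + if b = 1 then h w none else 0

/-- The sum of the entries of the block `b` of `V⁻¹ h`. -/
noncomputable def dualBlockSum (b : ZMod (2 * l)) (w : ℂ) : ℂ :=
  expNeg l u (some b) w * h w (some b) + if b = 1 then expNeg l u none w * h w none else 0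

lemma exp_mul_expNeg (α : Index l) (w : ℂ) :
    Complex.exp (logV l u α w) * expNeg l u α w = 1 := by
  rw [expNeg, ← Complex.exp_add]; simp

lemma conj_expNeg (α : Index l) (w : ℂ) :
    (starRingEnd ℂ) (expNeg l u α w) = expNeg l u α w := by
  rw [expNeg, ← Complex.exp_conj]; simp

lemma conj_exp_logV (α : Index l) (w : ℂ) :
    (starRingEnd ℂ) (Complex.exp (logV l u α w)) = Complex.exp (logV l u α w) := by
  rw [← Complex.exp_conj]; simp

lemma sum_block (b : ZMod (2 * l)) [NeZero l] (f : Index l → ℂ) :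
    ∑ β, (if block β = b then f β else 0) = f (some b) + if b = 1 then f none else 0 := by
  rw [Fintype.sum_option]
  simp only [block]
  simp [add_comm, eq_comm]

variable [NeZero l]

lemma V_inv (w : ℂ) : (V l u w)⁻¹ = Matrix.diagonal fun a => expNeg l u a w := by
  refine Matrix.inv_eq_left_inv ?_
  rw [V, Matrix.diagonal_mul_diagonal, ← Matrix.diagonal_one]
  congr 1
  funext a
  rw [expNeg, Complex.ofReal_exp, ← Complex.exp_add]
  simp

lemma J_mulVec (x : Index l → ℂ) (α : Index l) :
    (J l *ᵥ x) α = x (some (block α + 1)) + if block α + 1 = 1 then x none else 0 := by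
  rw [← sum_block]
  simp [J, Matrix.mulVec, dotProduct]

lemma J_transpose_mulVec (x : Index l → ℂ) (α : Index l) :
    ((J l)ᵀ *ᵥ x) α = x (some (block α - 1)) + if block α - 1 = 1 then x none else 0 := by
  rw [← sum_block]
  simp [J, Matrix.mulVec, dotProduct, eq_sub_iff_add_eq, eq_comm]

variable {u h} {U : Set ℂ} {μ : ℂ} {w : ℂ}

lemma hasWirtinger_logV (hl : 3 ≤ l) (hU : IsOpen U) (hu : IsTodaSolution l U u) (hw : w ∈ U)
    (α : Index l) :
    HasWirtinger (fun x => (logV l u α x : ℂ)) (dz (fun x => (logV l u α x : ℂ)) w)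
      (dzbar (fun x => (logV l u α x : ℂ)) w) w :=
  .of_differentiableAt (((contDiffOn_ofReal (contDiffOn_logV hl hu α)).contDiffAt
    (hU.mem_nhds hw)).differentiableAt (by norm_num))

lemma P_mulVec (hl : 3 ≤ l) (hU : IsOpen U) (hu : IsTodaSolution l U u) (hw : w ∈ U)
    (x : Index l → ℂ) (α : Index l) :
    (P l u w *ᵥ x) α = dz (fun p => (logV l u α p : ℂ)) w * x α := by
  have : P l u w = Matrix.diagonal fun α => dz (fun p => (logV l u α p : ℂ)) w := by
    ext a b
    rw [P, V_inv, Matrix.mul_diagonal, Matrix.of_apply]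
    by_cases hab : a = b
    · subst hab
      have h1 := (hasWirtinger_logV hl hU hu hw a).cexp.dz_eq
      simp only [V, Matrix.diagonal_apply_eq, Complex.ofReal_exp]
      rw [h1, expNeg, mul_right_comm, ← Complex.exp_add]
      simp
    · simp only [V, Matrix.diagonal_apply_ne _ hab]
      rw [(HasWirtinger.const (w := w) 0).dz_eq, zero_mul]
  rw [this, Matrix.mulVec_diagonal]

lemma Q_mulVec (w : ℂ) (α : Index l) :
    (Q l u w *ᵥ h w) α = Complex.exp (logV l u α w) * dualBlockSum u h (block α - 1) w := by
  rw [Q, ← Matrix.mulVec_mulVec, ← Matrix.mulVec_mulVec, V, Matrix.mulVec_diagonal,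
    J_transpose_mulVec, ← V, V_inv, Matrix.mulVec_diagonal, Matrix.mulVec_diagonal,
    Complex.ofReal_exp, dualBlockSum]

/-- Here `P` is diagonal with entries $\partial_z v_\alpha$, where $v_\alpha$ is `logV`; `J` shifts
the block up and `Q` shifts it down. -/
lemma hasWirtinger_entry (hl : 3 ≤ l) (hU : IsOpen U) (hu : IsTodaSolution l U u)
    (hh : IsLaxSolution l U u μ h) (hw : w ∈ U) (α : Index l) :
    HasWirtinger (fun x => h x α)
      (μ * blockSum h (block α + 1) w + dz (fun p => (logV l u α p : ℂ)) w * h w α)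
      (μ⁻¹ * (Complex.exp (logV l u α w) * dualBlockSum u h (block α - 1) w)) w := by
  have hd : DifferentiableAt ℝ (fun x => h x α) w :=
    differentiableAt_pi.mp (hh.differentiableOn.differentiableAt (hU.mem_nhds hw)) α
  refine (HasWirtinger.of_differentiableAt hd).congr_deriv ?_ ?_
  · rw [congrFun (hh.eq_z w hw) α, Matrix.add_mulVec, Pi.add_apply, Matrix.smul_mulVec,
      Pi.smul_apply, P_mulVec hl hU hu hw, J_mulVec, smul_eq_mul, blockSum]
  · rw [congrFun (hh.eq_zbar w hw) α, Matrix.smul_mulVec, Pi.smul_apply, Q_mulVec, smul_eq_mul]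

lemma hasWirtinger_expNeg (hl : 3 ≤ l) (hU : IsOpen U) (hu : IsTodaSolution l U u) (hw : w ∈ U)
    (α : Index l) :
    HasWirtinger (expNeg l u α) (-(expNeg l u α w * dz (fun p => (logV l u α p : ℂ)) w))
      (-(expNeg l u α w * dzbar (fun p => (logV l u α p : ℂ)) w)) w := by
  have := ((hasWirtinger_logV hl hU hu hw α).const_mul (-1)).cexp
  simp only [neg_one_mul] at this
  exact this.congr_deriv (by rw [expNeg]; ring) (by rw [expNeg]; ring)

/-- `h` is as smooth as the Lax pair allows. -/
lemma contDiffOn_entry (hl : 3 ≤ l) (hU : IsOpen U) (hu : IsTodaSolution l U u)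
    (hh : IsLaxSolution l U u μ h) (α : Index l) : ContDiffOn ℝ 2 (fun x => h x α) U := by
  have hv := fun α => contDiffOn_ofReal (contDiffOn_logV hl hu α)
  -- Bootstrapping with a gain of one derivative per step. It stops at $C^2$ because $\partial_z
  -- v_\alpha$ is only known to be $C^1$.
  have step : ∀ n : ℕ, n ≤ 1 → (∀ α, ContDiffOn ℝ n (fun x => h x α) U) →
      ∀ α, ContDiffOn ℝ (n + 1) (fun x => h x α) U := by
    intro n hn hc α
    have hn1 : (n : WithTop ℕ∞) ≤ 1 := by exact_mod_cast hn
    have hn2 : (n : WithTop ℕ∞) ≤ 2 := hn1.trans (by norm_num)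
    have he : ∀ α, ContDiffOn ℝ n (fun x => expNeg l u α x * h x α) U := fun α =>
      ((((hv α).of_le hn2).neg).cexp).mul (hc α)
    refine contDiffOn_succ_of_hasWirtinger hU
      (fun w hw => hasWirtinger_entry hl hU hu hh hw α) ?_ ?_
    · refine (contDiffOn_const.mul ?_).add
        (((contDiffOn_dz hU (hv α)).of_le hn1).mul (hc α))
      unfold blockSum
      refine (hc _).add ?_
      split_ifs
      · exact hc none
      · exact contDiffOn_const
    · refine contDiffOn_const.mul ((((hv α).of_le hn2).cexp).mul ?_)
      unfold dualBlockSum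
      refine (he _).add ?_
      split_ifs
      · exact he none
      · exact contDiffOn_const
  have h0 : ∀ α, ContDiffOn ℝ ((0 : ℕ) : WithTop ℕ∞) (fun x => h x α) U := fun α =>
    contDiffOn_zero.mpr fun w hw =>
      (hasWirtinger_entry hl hU hu hh hw α).differentiableAt.continuousAt.continuousWithinAt
  have h1 := step 0 (by norm_num) h0
  have h2 := step 1 le_rfl (fun α => by simpa using h1 α) α
  norm_num at h2
  exact h2

end

/-! ### The functions `gram` and `potential` and their first derivatives -/

section
variable {l : ℕ} (μ : ℂ) (u : ℕ → ℂ → ℝ) (h : ℂ → Index l → ℂ)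

/-- The contribution of the block `b` to the Hermitian form `h* V⁻¹ h`. -/
noncomputable def density (b : ZMod (2 * l)) (w : ℂ) : ℂ :=
  expNeg l u (some b) w * ((starRingEnd ℂ) (h w (some b)) * h w (some b)) +
    if b = 1 then expNeg l u none w * ((starRingEnd ℂ) (h w none) * h w none) else 0

/-- The terms of the quadratic constraint. -/
noncomputable def pairing (c : ZMod (2 * l)) (w : ℂ) : ℂ :=
  if c = 1 then 2 * (h w (some 1) * h w none)
  else altSign c * (h w (some (2 - c)) * h w (some c))

/-- The `γ_j`, indexed by blocks: `gram b = γ_{2-b}`. -/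
noncomputable def gram [NeZero l] (b : ZMod (2 * l)) (w : ℂ) : ℂ :=
  ∑ c, (1 - (μ * (starRingEnd ℂ) μ) ^ (2 * l))⁻¹ *
    (-(μ * (starRingEnd ℂ) μ)) ^ (c - b).val * density u h c w

/-- The quadratic part of `g_j`. -/
noncomputable def potential [NeZero l] (j : ZMod (2 * l)) (w : ℂ) : ℂ :=
  ∑ c, (1 / (2 * l) : ℂ) * ((c - j).val : ℂ) * pairing h c w

/-- The derivative `∂_z` of `gram b`. -/
noncomputable def gramDz (b : ZMod (2 * l)) (w : ℂ) : ℂ :=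
  ((starRingEnd ℂ) μ)⁻¹ * ((starRingEnd ℂ) (dualBlockSum u h (b - 1) w) * blockSum h b w)

/-- The derivative `∂_z` of `potential j`. -/
noncomputable def potentialDz (j : ZMod (2 * l)) (w : ℂ) : ℂ :=
  -(μ * altSign j) * (blockSum h (3 - j) w * blockSum h j w)

/-- The derivative `∂_z̄` of `potential j`. -/
noncomputable def potentialDzbar (j : ZMod (2 * l)) (w : ℂ) : ℂ :=
  -(μ⁻¹ * altSign j) * (dualBlockSum u h (2 - j) w * dualBlockSum u h (j - 1) w)

variable [NeZero l] {μ u h} {U : Set ℂ} {w : ℂ}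

lemma conj_dz_logV (hl : 3 ≤ l) (hU : IsOpen U) (hu : IsTodaSolution l U u) (hw : w ∈ U)
    (α : Index l) :
    (starRingEnd ℂ) (dzbar (fun p => (logV l u α p : ℂ)) w) =
      dz (fun p => (logV l u α p : ℂ)) w := by
  rw [← (hasWirtinger_logV hl hU hu hw α).conj_dz_ofReal, Complex.conj_conj]

/-- For $V^{-1}h$ the gauge term moves to the other equation: in $\partial_z(e^{-v_\alpha}h_\alpha)$
the derivative of $v_\alpha$ cancels. After conjugation the $\partial_{\bar z}$ derivative is
therefore free of derivatives of $u$, which keeps the mixed second derivatives computed later free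
of them as well. -/
lemma hasWirtinger_conj_dual_entry (hl : 3 ≤ l) (hU : IsOpen U) (hu : IsTodaSolution l U u)
    (hh : IsLaxSolution l U u μ h) (hw : w ∈ U) (α : Index l) :
    HasWirtinger (fun x => (starRingEnd ℂ) (expNeg l u α x * h x α))
      (((starRingEnd ℂ) μ)⁻¹ * (starRingEnd ℂ) (dualBlockSum u h (block α - 1) w)
        - (expNeg l u α w * dz (fun p => (logV l u α p : ℂ)) w) * (starRingEnd ℂ) (h w α))
      ((starRingEnd ℂ) μ * expNeg l u α w * (starRingEnd ℂ) (blockSum h (block α + 1) w)) w := by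
  refine ((hasWirtinger_expNeg hl hU hu hw α).mul
    (hasWirtinger_entry hl hU hu hh hw α)).star.congr_deriv ?_ ?_
  · have e := exp_mul_expNeg (u := u) α w
    simp only [map_add, map_mul, map_neg, map_inv₀, conj_expNeg, conj_exp_logV,
      conj_dz_logV hl hU hu hw]
    linear_combination
      ((starRingEnd ℂ) μ)⁻¹ * (starRingEnd ℂ) (dualBlockSum u h (block α - 1) w) * e
  · simp only [map_add, map_mul, map_neg, conj_expNeg]
    ring

lemma hasWirtinger_density_entry (hl : 3 ≤ l) (hU : IsOpen U) (hu : IsTodaSolution l U u)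
    (hh : IsLaxSolution l U u μ h) (hw : w ∈ U) (α : Index l) :
    HasWirtinger (fun x => expNeg l u α x * ((starRingEnd ℂ) (h x α) * h x α))
      (μ * (expNeg l u α w * (starRingEnd ℂ) (h w α)) * blockSum h (block α + 1) w +
        ((starRingEnd ℂ) μ)⁻¹ * (starRingEnd ℂ) (dualBlockSum u h (block α - 1) w) * h w α)
      ((starRingEnd ℂ) μ * (expNeg l u α w * h w α) *
          (starRingEnd ℂ) (blockSum h (block α + 1) w) +
        μ⁻¹ * dualBlockSum u h (block α - 1) w * (starRingEnd ℂ) (h w α)) w := by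
  have := (hasWirtinger_conj_dual_entry hl hU hu hh hw α).mul
    (hasWirtinger_entry hl hU hu hh hw α)
  simp only [map_mul, conj_expNeg] at this
  refine (this.congr_deriv ?_ ?_).congr_of_eventuallyEq (Filter.Eventually.of_forall fun x => ?_)
  · ring
  · linear_combination
      μ⁻¹ * dualBlockSum u h (block α - 1) w * (starRingEnd ℂ) (h w α) *
        exp_mul_expNeg (u := u) α w
  · ring

omit [NeZero l] in
lemma conj_mul_gramDz_succ (hμ : μ ≠ 0) (b : ZMod (2 * l)) (w : ℂ) :
    μ * (starRingEnd ℂ) μ * gramDz μ u h (b + 1) w =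
      μ * ((starRingEnd ℂ) (dualBlockSum u h b w) * blockSum h (b + 1) w) := by
  have : (starRingEnd ℂ) μ ≠ 0 := (map_ne_zero _).mpr hμ
  rw [gramDz, add_sub_cancel_right]
  field_simp

/-- The coupling of block $b$ to $b+1$ and its coupling to $b-1$ have the same form, shifted by one
index and scaled by $|\mu|^2$. The derivative thus already has the shape $X_b+|\mu|^2X_{b+1}$ that
`gram_weights` inverts. -/
lemma hasWirtinger_density (hl : 3 ≤ l) (hU : IsOpen U) (hu : IsTodaSolution l U u)
    (hh : IsLaxSolution l U u μ h) (hμ : μ ≠ 0) (hw : w ∈ U) (b : ZMod (2 * l)) :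
    HasWirtinger (density u h b)
      (gramDz μ u h b w + μ * (starRingEnd ℂ) μ * gramDz μ u h (b + 1) w)
      ((starRingEnd ℂ) (gramDz μ u h b w) +
        μ * (starRingEnd ℂ) μ * (starRingEnd ℂ) (gramDz μ u h (b + 1) w)) w := by
  have e := conj_mul_gramDz_succ (u := u) (h := h) hμ b w
  have e' := congrArg (starRingEnd ℂ) e
  simp only [map_mul, Complex.conj_conj] at e'
  rw [mul_comm ((starRingEnd ℂ) μ) μ] at e'
  rw [e, e', gramDz]
  simp only [map_mul, Complex.conj_conj, map_inv₀]
  have h1 := hasWirtinger_density_entry hl hU hu hh hw (some b)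
  simp only [block] at h1
  by_cases hb : b = 1
  · subst hb
    have h2 := hasWirtinger_density_entry hl hU hu hh hw none
    simp only [block] at h2
    refine ((h1.add h2).congr_deriv ?_ ?_).congr_of_eventuallyEq
      (Filter.Eventually.of_forall fun x => by simp [density])
    · rw [blockSum, dualBlockSum, blockSum, dualBlockSum]
      simp only [if_true, map_add, map_mul, conj_expNeg]
      ring
    · rw [blockSum, dualBlockSum, blockSum, dualBlockSum]
      simp only [if_true, map_add]
      ring
  · refine (h1.congr_deriv ?_ ?_).congr_of_eventuallyEq
      (Filter.Eventually.of_forall fun x => by simp [density, hb])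
    · rw [blockSum, dualBlockSum, blockSum, dualBlockSum]
      simp only [if_neg hb, map_add, map_mul, conj_expNeg, map_zero]
      ring
    · rw [blockSum, dualBlockSum, blockSum, dualBlockSum]
      simp only [if_neg hb, map_add, map_zero]
      ring

lemma one_sub_pow_ne_zero (hμ1 : ‖μ‖ ≠ 1) : 1 - (μ * (starRingEnd ℂ) μ) ^ (2 * l) ≠ 0 := by
  rw [Complex.mul_conj, Complex.normSq_eq_norm_sq, Complex.ofReal_pow, ← pow_mul]
  intro h0
  have h1 : ‖μ‖ ^ (2 * (2 * l)) = 1 := by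
    have : ((1 - ‖μ‖ ^ (2 * (2 * l)) : ℝ) : ℂ) = 0 := by push_cast at h0 ⊢; exact h0
    have := Complex.ofReal_eq_zero.mp this
    linarith
  have hl0 : l ≠ 0 := NeZero.ne l
  exact hμ1 ((pow_eq_one_iff_of_nonneg (norm_nonneg μ) (by omega)).mp h1)

lemma gram_weights (hl : 3 ≤ l) (hμ1 : ‖μ‖ ≠ 1) (X : ZMod (2 * l) → ℂ) (b : ZMod (2 * l)) :
    ∑ c, (1 - (μ * (starRingEnd ℂ) μ) ^ (2 * l))⁻¹ * (-(μ * (starRingEnd ℂ) μ)) ^ (c - b).val *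
      (X c + μ * (starRingEnd ℂ) μ * X (c + 1)) = X b := by
  have := sum_neg_pow_val (2 * l) (by omega) (even_two_mul l) (μ * (starRingEnd ℂ) μ) X b
  simp_rw [mul_assoc _ ((-(μ * (starRingEnd ℂ) μ)) ^ _)]
  rw [← Finset.mul_sum, this, inv_mul_cancel_left₀ (one_sub_pow_ne_zero hμ1)]

lemma hasWirtinger_gram (hl : 3 ≤ l) (hU : IsOpen U) (hu : IsTodaSolution l U u)
    (hh : IsLaxSolution l U u μ h) (hμ : μ ≠ 0) (hμ1 : ‖μ‖ ≠ 1) (hw : w ∈ U)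
    (b : ZMod (2 * l)) :
    HasWirtinger (gram μ u h b) (gramDz μ u h b w) ((starRingEnd ℂ) (gramDz μ u h b w)) w := by
  have := HasWirtinger.sum Finset.univ fun c _ =>
    (hasWirtinger_density hl hU hu hh hμ hw c).const_mul
      ((1 - (μ * (starRingEnd ℂ) μ) ^ (2 * l))⁻¹ * (-(μ * (starRingEnd ℂ) μ)) ^ (c - b).val)
  exact this.congr_deriv (gram_weights hl hμ1 (fun c => gramDz μ u h c w) b)
    (gram_weights hl hμ1 (fun c => (starRingEnd ℂ) (gramDz μ u h c w)) b)

/-- The weights depend only on $c-b$, so they commute with the cyclic shift: inverting the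
recurrence and then applying it returns the density. -/
lemma density_eq_gram_add (hl : 3 ≤ l) (hμ1 : ‖μ‖ ≠ 1) (b : ZMod (2 * l)) (w : ℂ) :
    density u h b w = gram μ u h b w + μ * (starRingEnd ℂ) μ * gram μ u h (b + 1) w := by
  rw [← gram_weights hl hμ1 (fun c => density u h c w) b]
  have : gram μ u h (b + 1) w = ∑ c, (1 - (μ * (starRingEnd ℂ) μ) ^ (2 * l))⁻¹ *
      (-(μ * (starRingEnd ℂ) μ)) ^ (c - b).val * density u h (c + 1) w := by
    symm
    refine Fintype.sum_equiv (Equiv.addRight 1) _ _ fun c => ?_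
    simp only [Equiv.coe_addRight]
    rw [add_sub_add_right_eq_sub]
  rw [this, gram, Finset.mul_sum, ← Finset.sum_add_distrib]
  exact Finset.sum_congr rfl fun c _ => by ring

lemma pairing_two_sub (c : ZMod (2 * l)) (w : ℂ) :
    pairing h (2 - c) w = pairing h c w := by
  unfold pairing
  have : (2 - c = 1) ↔ c = 1 := ⟨fun e => by linear_combination -e, fun e => by rw [e]; ring⟩
  by_cases hc : c = 1
  · rw [if_pos hc, if_pos (this.mpr hc)]
  · rw [if_neg hc, if_neg (this.not.mpr hc), altSign_two_sub, sub_sub_cancel]; ring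

/-- The constraint says that the total pairing vanishes. -/
lemma sum_pairing (hl : 3 ≤ l)
    (hc : 2 * h w (some 1) * h w none + (-1 : ℂ) ^ l * h w (some ((l : ZMod (2 * l)) + 1)) ^ 2
        + 2 * ∑ c ∈ Finset.Icc 2 l, (-1 : ℂ) ^ (c - 1) *
            h w (some (c : ZMod (2 * l))) * h w (some (2 - (c : ZMod (2 * l)))) = 0) :
    ∑ c, pairing h c w = 0 := by
  rw [sum_zmod_eq_split hl]
  simp_rw [pairing_two_sub]
  have h1 : pairing h ((l : ZMod (2 * l)) + 1) w =
      (-1 : ℂ) ^ l * h w (some ((l : ZMod (2 * l)) + 1)) ^ 2 := by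
    have e : (2 - ((l : ZMod (2 * l)) + 1)) = (l : ZMod (2 * l)) + 1 := by
      have := ZMod.natCast_self (2 * l)
      push_cast at this
      linear_combination -this
    have e2 : (l : ZMod (2 * l)) + 1 ≠ 1 := by
      have := natCast_ne_natCast (l := l) (a := l + 1) (b := 1) (by omega) (by omega) (by omega)
      push_cast at this
      exact this
    rw [pairing, if_neg e2, e, altSign_add_one, altSign_natCast, pow_succ]
    ring
  have h2 : ∑ c ∈ Finset.Icc 2 l, pairing h (c : ZMod (2 * l)) w =
      ∑ c ∈ Finset.Icc 2 l, (-1 : ℂ) ^ (c - 1) *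
            h w (some (c : ZMod (2 * l))) * h w (some (2 - (c : ZMod (2 * l)))) := by
    refine Finset.sum_congr rfl fun c hc => ?_
    rw [Finset.mem_Icc] at hc
    have e2 : (c : ZMod (2 * l)) ≠ 1 := by
      have := natCast_ne_natCast (l := l) (a := c) (b := 1) (by omega) (by omega) (by omega)
      rwa [Nat.cast_one] at this
    obtain ⟨k, rfl⟩ : ∃ k, c = k + 1 := ⟨c - 1, by omega⟩
    rw [pairing, if_neg e2, altSign_natCast, pow_succ, pow_succ, Nat.add_sub_cancel]
    ring
  rw [h1, h2, pairing, if_pos rfl]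
  linear_combination hc

lemma potentialDz_three_sub (j : ZMod (2 * l)) (w : ℂ) :
    potentialDz μ h (3 - j) w = -potentialDz μ h j w := by
  rw [potentialDz, potentialDz, sub_sub_cancel,
    show (3 - j : ZMod (2 * l)) = 2 - (j - 1) by ring, altSign_two_sub, altSign_sub_one]
  ring

lemma potentialDzbar_three_sub (j : ZMod (2 * l)) (w : ℂ) :
    potentialDzbar μ u h (3 - j) w = -potentialDzbar μ u h j w := by
  rw [potentialDzbar, potentialDzbar, show (2 - (3 - j) : ZMod (2 * l)) = j - 1 by ring,
    show (3 - j - 1 : ZMod (2 * l)) = 2 - j by ring,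
    show (3 - j : ZMod (2 * l)) = 2 - (j - 1) by ring, altSign_two_sub, altSign_sub_one]
  ring

lemma sum_eq_zero_of_three_sub {X : ZMod (2 * l) → ℂ} (hX : ∀ j, X (3 - j) = -X j) :
    ∑ j, X j = 0 := by
  have h1 : ∑ j, X (3 - j) = ∑ j, X j :=
    Fintype.sum_equiv (Equiv.subLeft 3) _ _ fun c => rfl
  simp_rw [hX, Finset.sum_neg_distrib] at h1
  linear_combination (-1 / 2 : ℂ) * h1

/-- In each product of reflected entries the derivatives of $v$ cancel, since the two entries of $V$
are inverse to each other. What remains is a coupling across the link from $c$ to $c+1$ and one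
across the link from $c-1$ to $c$, with opposite signs, hence a cyclic difference. Block 1 is
separate because its two entries are paired with each other, which accounts for the factor $2$. -/
lemma hasWirtinger_pairing (hl : 3 ≤ l) (hU : IsOpen U) (hu : IsTodaSolution l U u)
    (hh : IsLaxSolution l U u μ h) (hw : w ∈ U) (c : ZMod (2 * l)) :
    HasWirtinger (pairing h c) (potentialDz μ h (c + 1) w - potentialDz μ h c w)
      (potentialDzbar μ u h (c + 1) w - potentialDzbar μ u h c w) w := by
  have e1 : (3 - (c + 1) : ZMod (2 * l)) = 2 - c := by ring
  have e2 : (2 - (c + 1) : ZMod (2 * l)) = 1 - c := by ring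
  by_cases hc : c = 1
  · subst hc
    have h1 := hasWirtinger_entry hl hU hu hh hw (some 1)
    have h2 := hasWirtinger_entry hl hU hu hh hw none
    refine (((h1.mul h2).const_mul 2).congr_deriv ?_ ?_).congr_of_eventuallyEq
      (Filter.Eventually.of_forall fun x => by simp [pairing])
    · simp only [potentialDz, altSign_add_one, altSign_one, block]
      have hz : (logV l u none) = fun p => -logV l u (some 1) p := by
        funext p; rw [logV_some_one u p hl]; rfl
      have hz2 : dz (fun p => (logV l u none p : ℂ)) w =
          -dz (fun p => (logV l u (some 1) p : ℂ)) w := by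
        have := ((hasWirtinger_logV hl hU hu hw (some 1)).const_mul (-1)).dz_eq
        rw [hz]
        simp only [neg_mul, one_mul] at this
        simp only [Complex.ofReal_neg]
        exact this
      rw [hz2, e1, show (2 - 1 : ZMod (2 * l)) = 1 by ring,
        show (3 - 1 : ZMod (2 * l)) = 1 + 1 by ring]
      have : blockSum h 1 w = h w (some 1) + h w none := by simp [blockSum]
      rw [this]
      ring
    · simp only [potentialDzbar, altSign_add_one, altSign_one, block, add_sub_cancel_right]
      rw [e2, show (2 - 1 : ZMod (2 * l)) = 1 by ring]
      have hv : (Complex.exp (logV l u (some 1) w)) = expNeg l u none w := by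
        rw [expNeg, logV_some_one u w hl, logV]; simp
      have hv' : (Complex.exp (logV l u none w)) = expNeg l u (some 1) w := by
        rw [expNeg, logV_some_one u w hl, logV]; simp
      have : dualBlockSum u h 1 w =
          expNeg l u (some 1) w * h w (some 1) + expNeg l u none w * h w none := by
        simp [dualBlockSum]
      rw [this, hv, hv']
      ring
  · have hc2 : 2 - c ≠ 1 := fun e => hc (by linear_combination -e)
    have h1 := hasWirtinger_entry hl hU hu hh hw (some (2 - c))
    have h2 := hasWirtinger_entry hl hU hu hh hw (some c)
    have hz := fun p => logV_two_sub u p hl hc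
    refine (((h1.mul h2).const_mul (altSign c)).congr_deriv ?_ ?_).congr_of_eventuallyEq
      (Filter.Eventually.of_forall fun x => by simp [pairing, hc])
    · have hz2 : dz (fun p => (logV l u (some (2 - c)) p : ℂ)) w =
          -dz (fun p => (logV l u (some c) p : ℂ)) w := by
        have := ((hasWirtinger_logV hl hU hu hw (some c)).const_mul (-1)).dz_eq
        simp only [neg_mul, one_mul] at this
        simp only [hz, Complex.ofReal_neg]
        exact this
      simp only [potentialDz, altSign_add_one, block]
      rw [hz2, e1, show (2 - c + 1 : ZMod (2 * l)) = 3 - c by ring]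
      have b1 : blockSum h c w = h w (some c) := by simp [blockSum, hc]
      have b2 : blockSum h (2 - c) w = h w (some (2 - c)) := by simp [blockSum, hc2]
      rw [b1, b2]
      ring
    · simp only [potentialDzbar, altSign_add_one, block, add_sub_cancel_right]
      rw [e2, show (2 - c - 1 : ZMod (2 * l)) = 1 - c by ring]
      have hv : Complex.exp (logV l u (some (2 - c)) w) = expNeg l u (some c) w := by
        rw [expNeg, hz]; simp
      have hv' : Complex.exp (logV l u (some c) w) = expNeg l u (some (2 - c)) w := by
        rw [expNeg, hz]; simp
      have b1 : dualBlockSum u h c w = expNeg l u (some c) w * h w (some c) := by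
        simp [dualBlockSum, hc]
      have b2 : dualBlockSum u h (2 - c) w =
          expNeg l u (some (2 - c)) w * h w (some (2 - c)) := by
        simp [dualBlockSum, hc2]
      rw [b1, b2, hv, hv']
      ring

/-- The sawtooth of `sum_val_mul_sub`, normalised by $1/(2l)$. It is used with the derivatives,
whose sums vanish by antisymmetry under $j\mapsto3-j$, and with the pairings, whose sum vanishes by
the constraint. -/
lemma potential_weights (hl : 3 ≤ l) {X : ZMod (2 * l) → ℂ} (hX : ∑ j, X j = 0)
    (j : ZMod (2 * l)) :
    ∑ c, (1 / (2 * l) : ℂ) * ((c - j).val : ℂ) * (X (c + 1) - X c) = X j := by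
  have := sum_val_mul_sub (2 * l) (by omega) X j
  rw [hX] at this
  have hl0 : (l : ℂ) ≠ 0 := by exact_mod_cast NeZero.ne l
  have h2 : ∑ c, (1 / (2 * l) : ℂ) * ((c - j).val : ℂ) * (X (c + 1) - X c) =
      -(1 / (2 * l)) * ∑ c, ((c - j).val : ℂ) * (X c - X (c + 1)) := by
    rw [Finset.mul_sum]
    refine Finset.sum_congr rfl fun c _ => ?_
    ring
  rw [h2, this]
  push_cast
  field_simp
  ring

lemma hasWirtinger_potential (hl : 3 ≤ l) (hU : IsOpen U) (hu : IsTodaSolution l U u)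
    (hh : IsLaxSolution l U u μ h) (hw : w ∈ U) (j : ZMod (2 * l)) :
    HasWirtinger (potential h j) (potentialDz μ h j w) (potentialDzbar μ u h j w) w := by
  have := HasWirtinger.sum Finset.univ fun c _ =>
    (hasWirtinger_pairing hl hU hu hh hw c).const_mul ((1 / (2 * l) : ℂ) * ((c - j).val : ℂ))
  exact this.congr_deriv
    (potential_weights hl (X := fun c => potentialDz μ h c w)
      (sum_eq_zero_of_three_sub fun j => potentialDz_three_sub j w) j)
    (potential_weights hl (X := fun c => potentialDzbar μ u h c w)
      (sum_eq_zero_of_three_sub fun j => potentialDzbar_three_sub j w) j)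

lemma potential_succ (hl : 3 ≤ l) (hs : ∑ c, pairing h c w = 0) (j : ZMod (2 * l)) :
    potential h (j + 1) w = potential h j w + pairing h j w := by
  have h1 := potential_weights hl hs j
  have h2 : potential h (j + 1) w =
      ∑ c, (1 / (2 * l) : ℂ) * ((c - j).val : ℂ) * pairing h (c + 1) w := by
    symm
    refine Fintype.sum_equiv (Equiv.addRight 1) _ _ fun c => ?_
    simp only [Equiv.coe_addRight]
    rw [add_sub_add_right_eq_sub]
  rw [h2, ← h1, potential, ← Finset.sum_add_distrib]
  exact Finset.sum_congr rfl fun c _ => by ring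

lemma sum_potential (hs : ∑ c, pairing h c w = 0) : ∑ j, potential h j w = 0 := by
  unfold potential
  rw [Finset.sum_comm]
  have : ∀ c : ZMod (2 * l), ∑ j, ((c - j).val : ℂ) = ∑ j : ZMod (2 * l), (j.val : ℂ) := fun c =>
    Fintype.sum_equiv (Equiv.subLeft c) _ _ fun j => rfl
  simp_rw [mul_assoc, ← Finset.mul_sum, ← Finset.sum_mul, this, ← Finset.mul_sum, hs]
  simp

/-- `potential` is antisymmetric under `j ↦ 3 - j`. -/
lemma potential_three_sub (hl : 3 ≤ l) (hs : ∑ c, pairing h c w = 0) (j : ZMod (2 * l)) :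
    potential h (3 - j) w = -potential h j w := by
  have hstep : ∀ k : ZMod (2 * l), potential h (3 - (k + 1)) w + potential h (k + 1) w =
      potential h (3 - k) w + potential h k w := fun k => by
    have h1 := potential_succ hl hs k
    have h2 := potential_succ hl hs (2 - k)
    rw [pairing_two_sub, show (2 - k + 1 : ZMod (2 * l)) = 3 - k by ring] at h2
    rw [show (3 - (k + 1) : ZMod (2 * l)) = 2 - k by ring, h1, h2]
    ring
  have hconst : ∀ k : ZMod (2 * l), potential h (3 - k) w + potential h k w =
      potential h (3 - 0) w + potential h 0 w := by
    have : ∀ n : ℕ, potential h (3 - (n : ZMod (2 * l))) w + potential h (n : ZMod (2 * l)) w =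
        potential h (3 - 0) w + potential h 0 w := by
      intro n
      induction n with
      | zero => rw [Nat.cast_zero]
      | succ n ih => rw [Nat.cast_succ, hstep, ih]
    intro k
    have := this k.val
    rwa [ZMod.natCast_zmod_val] at this
  -- The sum of the values at $k$ and $3-k$ is independent of $k$; its total over the cycle is zero,
  -- so the constant is zero.
  have htot : ∑ k : ZMod (2 * l), (potential h (3 - k) w + potential h k w) = 0 := by
    have h1 : ∑ k : ZMod (2 * l), potential h (3 - k) w = ∑ k, potential h k w :=
      Fintype.sum_equiv (Equiv.subLeft 3) _ _ fun c => rfl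
    rw [Finset.sum_add_distrib, h1, sum_potential hs, add_zero]
  rw [Finset.sum_congr rfl fun k _ => (hconst k).trans (hconst j).symm, Finset.sum_const,
    Finset.card_univ, ZMod.card, nsmul_eq_mul, mul_eq_zero] at htot
  rcases htot with h0 | h0
  · exact absurd (by exact_mod_cast h0) (NeZero.ne (2 * l))
  · linear_combination h0

end

/-! ### Algebraic identities for the bilinear equations -/

/-- The algebraic identity behind the bilinear equation for `g_j`, away from the block of size `2`. -/
lemma bilinear_identity {μ ν ε P Pi Q Qi : ℂ} (hμ : μ ≠ 0) (hν : ν ≠ 0) (hε : ε * ε = 1)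
    (hP : Pi * P = 1) (hQ : Qi * Q = 1) (a a' Γ Γ' Γ₁ Γ₂ Γ₃ Γ₄ x x' y y' x₁ x₁' y₁ y₁' : ℂ)
    (h1 : P * (x' * x) = Γ + μ * ν * Γ₁) (h2 : Q * (y' * y) = Γ₂ + μ * ν * Γ)
    (h3 : Qi * (x₁' * x₁) = Γ' + μ * ν * Γ₃) (h4 : Pi * (y₁' * y₁) = Γ₄ + μ * ν * Γ') :
    (-(ε * (Pi * Q * (y₁ * x + x₁ * y))) * a' + -(μ * ε) * (x₁ * x) * (-(ν * ε) * (x₁' * x'))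
        + (-(μ⁻¹ * ε) * (Pi * y₁ * (Q * y)) * (-(ν⁻¹ * ε) * (Pi * y₁' * (Q * y')))
          + a * -(ε * (Pi * Q * (y₁' * x' + x₁' * y'))))
        - μ * ν * (Pi * Q * (P * (x' * x) + (μ * ν)⁻¹ * (Q * (y' * y))) * Γ'
          + ν⁻¹ * (Q * y' * x) * (μ⁻¹ * (Pi * y₁ * x₁'))
          + (μ⁻¹ * (Q * y * x') * (ν⁻¹ * (Pi * y₁' * x₁))
          + Γ * (Pi * Q * (Qi * (x₁' * x₁) + (μ * ν)⁻¹ * (Pi * (y₁' * y₁)))))))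
      * (a * a' - μ * ν * (Γ * Γ'))
    - (-(μ * ε) * (x₁ * x) * a' + a * (-(ν⁻¹ * ε) * (Pi * y₁' * (Q * y')))
        - μ * ν * (ν⁻¹ * (Q * y' * x) * Γ' + Γ * (ν⁻¹ * (Pi * y₁' * x₁))))
      * (-(μ⁻¹ * ε) * (Pi * y₁ * (Q * y)) * a' + a * (-(ν * ε) * (x₁' * x'))
        - μ * ν * (μ⁻¹ * (Q * y * x') * Γ' + Γ * (μ⁻¹ * (Pi * y₁ * x₁'))))
    = Pi * Q * ((a * a' - μ * ν * (Γ * Γ')) ^ 2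
      - ((a + ε * (y₁ * x)) * (a' + ε * (y₁' * x')) - μ * ν * (Γ₁ * Γ₄))
        * ((a + ε * (x₁ * y)) * (a' + ε * (x₁' * y')) - μ * ν * (Γ₂ * Γ₃))) := by
  -- Conjugates are independent variables here. The recurrences at the four blocks $j$, $j-1$,
  -- $3-j$, $2-j$ eliminate the neighbours $\Gamma_1,\dots,\Gamma_4$ of $\Gamma$ and $\Gamma'$; once
  -- $\varepsilon=\pm1$ is fixed, an identity of rational functions remains.
  have hP0 : P ≠ 0 := right_ne_zero_of_mul_eq_one hP
  have hQ0 : Q ≠ 0 := right_ne_zero_of_mul_eq_one hQ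
  have e1 : Pi = P⁻¹ := eq_inv_of_mul_eq_one_left hP
  have e2 : Qi = Q⁻¹ := eq_inv_of_mul_eq_one_left hQ
  have e3 : Γ₁ = (P * (x' * x) - Γ) / (μ * ν) := by field_simp; linear_combination -h1
  have e4 : Γ₂ = Q * (y' * y) - μ * ν * Γ := by linear_combination -h2
  have e5 : Γ₃ = (Qi * (x₁' * x₁) - Γ') / (μ * ν) := by field_simp; linear_combination -h3
  have e6 : Γ₄ = Pi * (y₁' * y₁) - μ * ν * Γ' := by linear_combination -h4
  subst e3 e4 e5 e6
  subst e1 e2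
  rcases mul_self_eq_one_iff.mp hε with rfl | rfl
  · field_simp
    ring
  · field_simp
    ring

/-- The algebraic identity behind the bilinear equations at the block of size `2`. -/
lemma bilinear_identity_edge {μ ν P Pi Q Qi : ℂ} (hμ : μ ≠ 0) (hν : ν ≠ 0)
    (hP : P * Pi = 1) (hQ : Q * Qi = 1) (Γ Γ₂ Γ₃ Γ₀ x x' y y' z z' t t' : ℂ)
    (h1 : P * (x' * x) + Pi * (y' * y) = Γ + μ * ν * Γ₂)
    (h2 : Qi * (z' * z) = Γ₂ + μ * ν * Γ₃) (h3 : Q * (t' * t) = Γ₀ + μ * ν * Γ) :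
    (μ * (ν * P * z' * z + P * x' * (μ⁻¹ * (Q * (P * x + Pi * y))))
        - ν⁻¹ * (ν * Q * (x' + y') * y + Q * t' * (μ⁻¹ * (P * (Q * t)))))
      * (P * (x' * x) - Γ)
    - (μ * (P * x' * z) - ν⁻¹ * (Q * t' * y)) * (ν * (P * x * z') - μ⁻¹ * (Q * t * y'))
    = Q * P * ((P * (x' * x) - Γ) ^ 2
      - ((x * y - t * z) * (x' * y' - t' * z') - μ * ν * (Γ₃ * Γ₀))) := by
  -- The recurrences at the blocks $1$, $2$, $0$ eliminate $\Gamma_2$, $\Gamma_3$, $\Gamma_0$ in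
  -- turn; $\Gamma_3$ depends on $\Gamma_2$, hence the order of substitution.
  have hP0 : P ≠ 0 := left_ne_zero_of_mul_eq_one hP
  have hQ0 : Q ≠ 0 := left_ne_zero_of_mul_eq_one hQ
  have e1 : Pi = P⁻¹ := eq_inv_of_mul_eq_one_right hP
  have e2 : Qi = Q⁻¹ := eq_inv_of_mul_eq_one_right hQ
  have e3 : Γ₂ = (P * (x' * x) + Pi * (y' * y) - Γ) / (μ * ν) := by
    field_simp; linear_combination -h1
  have e4 : Γ₃ = (Qi * (z' * z) - Γ₂) / (μ * ν) := by field_simp; linear_combination -h2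
  have e5 : Γ₀ = Q * (t' * t) - μ * ν * Γ := by linear_combination -h3
  subst e4 e5
  subst e3
  subst e1 e2
  field_simp
  ring

/-! ### The functions $\tau_j$ and their bilinear equations -/

section
variable {l : ℕ} [NeZero l] (μ : ℂ) (u : ℕ → ℂ → ℝ) (h : ℂ → Index l → ℂ)

/-- The functions `g_j`, complex valued. -/
noncomputable def tau (j : ZMod (2 * l)) (w : ℂ) : ℂ :=
  potential h j w * (starRingEnd ℂ) (potential h j w) -
    μ * (starRingEnd ℂ) μ * (gram μ u h j w * gram μ u h (3 - j) w)

/-- The derivative `∂_z` of `tau j`. -/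
noncomputable def tauDz (j : ZMod (2 * l)) (w : ℂ) : ℂ :=
  potentialDz μ h j w * (starRingEnd ℂ) (potential h j w)
    + potential h j w * (starRingEnd ℂ) (potentialDzbar μ u h j w)
    - μ * (starRingEnd ℂ) μ * (gramDz μ u h j w * gram μ u h (3 - j) w
      + gram μ u h j w * gramDz μ u h (3 - j) w)

/-- The derivative `∂_z̄` of `tau j`. -/
noncomputable def tauDzbar (j : ZMod (2 * l)) (w : ℂ) : ℂ :=
  potentialDzbar μ u h j w * (starRingEnd ℂ) (potential h j w)
    + potential h j w * (starRingEnd ℂ) (potentialDz μ h j w)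
    - μ * (starRingEnd ℂ) μ * ((starRingEnd ℂ) (gramDz μ u h j w) * gram μ u h (3 - j) w
      + gram μ u h j w * (starRingEnd ℂ) (gramDz μ u h (3 - j) w))

/-- `|h_α|² e^{-v_α} - γ_1` for an entry `α` of the block of size `2`. -/
noncomputable def edge (α : Index l) (w : ℂ) : ℂ :=
  expNeg l u α w * ((starRingEnd ℂ) (h w α) * h w α) - gram μ u h 1 w

/-- The derivative `∂_z` of `edge α`, where `β` is the other entry of the block. -/
noncomputable def edgeDz (α β : Index l) (w : ℂ) : ℂ :=
  μ * ((starRingEnd ℂ) (expNeg l u α w * h w α) * h w (some 2))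
    - ((starRingEnd ℂ) μ)⁻¹ * ((starRingEnd ℂ) (expNeg l u (some 0) w * h w (some 0)) * h w β)

variable {μ u h} {U : Set ℂ} {w : ℂ}

lemma hasWirtinger_tau (hl : 3 ≤ l) (hU : IsOpen U) (hu : IsTodaSolution l U u)
    (hh : IsLaxSolution l U u μ h) (hμ : μ ≠ 0) (hμ1 : ‖μ‖ ≠ 1) (hw : w ∈ U)
    (j : ZMod (2 * l)) :
    HasWirtinger (tau μ u h j) (tauDz μ u h j w) (tauDzbar μ u h j w) w := by
  have ha := hasWirtinger_potential hl hU hu hh hw j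
  have hg := fun k => hasWirtinger_gram hl hU hu hh hμ hμ1 hw k
  exact (ha.mul ha.star).sub (((hg j).mul (hg (3 - j))).const_mul (μ * (starRingEnd ℂ) μ))

omit [NeZero l] in
lemma blockSum_of_ne {b : ZMod (2 * l)} (hb : b ≠ 1) (w : ℂ) :
    blockSum h b w = h w (some b) := by simp [blockSum, hb]

omit [NeZero l] in
lemma dualBlockSum_of_ne {b : ZMod (2 * l)} (hb : b ≠ 1) (w : ℂ) :
    dualBlockSum u h b w = expNeg l u (some b) w * h w (some b) := by simp [dualBlockSum, hb]

omit [NeZero l] in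
lemma density_of_ne {b : ZMod (2 * l)} (hb : b ≠ 1) (w : ℂ) :
    density u h b w =
      expNeg l u (some b) w * ((starRingEnd ℂ) (h w (some b)) * h w (some b)) := by
  simp [density, hb]

omit [NeZero l] in
lemma conj_altSign (j : ZMod (2 * l)) : (starRingEnd ℂ) (altSign j) = altSign j := by
  simp [altSign]

/-- Only the $\partial_{\bar z}$ derivative enters the Laplacian, so the other is left unspecified.
Excluding $j=1,2$ makes both block sums in `gramDz` single entries. -/
lemma hasWirtinger_gramDz (hl : 3 ≤ l) (hU : IsOpen U) (hu : IsTodaSolution l U u)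
    (hh : IsLaxSolution l U u μ h) (hμ : μ ≠ 0) (hw : w ∈ U) {j : ZMod (2 * l)}
    (hj1 : j ≠ 1) (hj2 : j ≠ 2) :
    ∃ r, HasWirtinger (gramDz μ u h j) r
      (Complex.exp (logV l u (some j) w) * expNeg l u (some (j - 1)) w *
        (density u h j w + (μ * (starRingEnd ℂ) μ)⁻¹ * density u h (j - 1) w)) w := by
  have hj : j - 1 ≠ 1 := fun e => hj2 (by linear_combination e)
  have hν : (starRingEnd ℂ) μ ≠ 0 := (map_ne_zero _).mpr hμ
  have := ((hasWirtinger_conj_dual_entry hl hU hu hh hw (some (j - 1))).mul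
    (hasWirtinger_entry hl hU hu hh hw (some j))).const_mul ((starRingEnd ℂ) μ)⁻¹
  refine ⟨_, (this.congr_deriv rfl ?_).congr_of_eventuallyEq
    (Filter.Eventually.of_forall fun x => by
      rw [gramDz, dualBlockSum_of_ne hj, blockSum_of_ne hj1])⟩
  simp only [block, sub_add_cancel]
  rw [blockSum_of_ne hj1, dualBlockSum_of_ne hj, density_of_ne hj1, density_of_ne hj, map_mul,
    conj_expNeg]
  have e := exp_mul_expNeg (u := u) (some j) w
  field_simp
  linear_combination
    -(expNeg l u (some (j - 1)) w * h w (some j) * μ * (starRingEnd ℂ) μ *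
      (starRingEnd ℂ) (h w (some j))) * e

lemma hasWirtinger_potentialDz (hl : 3 ≤ l) (hU : IsOpen U) (hu : IsTodaSolution l U u)
    (hh : IsLaxSolution l U u μ h) (hμ : μ ≠ 0) (hw : w ∈ U) {j : ZMod (2 * l)}
    (hj1 : j ≠ 1) (hj2 : j ≠ 2) :
    ∃ r, HasWirtinger (potentialDz μ h j) r
      (-(altSign j * (Complex.exp (logV l u (some j) w) * expNeg l u (some (j - 1)) w *
        (h w (some (2 - j)) * h w (some j) + h w (some (3 - j)) * h w (some (j - 1)))))) w := by
  have hj : j - 1 ≠ 1 := fun e => hj2 (by linear_combination e)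
  have hj' : 3 - j ≠ 1 := fun e => hj2 (by linear_combination -e)
  have hj'' : 2 - j ≠ 1 := fun e => hj1 (by linear_combination -e)
  have := ((hasWirtinger_entry hl hU hu hh hw (some (3 - j))).mul
    (hasWirtinger_entry hl hU hu hh hw (some j))).const_mul (-(μ * altSign j))
  refine ⟨_, (this.congr_deriv rfl ?_).congr_of_eventuallyEq
    (Filter.Eventually.of_forall fun x => by
      rw [potentialDz, blockSum_of_ne hj', blockSum_of_ne hj1])⟩
  simp only [block]
  have e1 : (3 - j - 1 : ZMod (2 * l)) = 2 - j := by ring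
  -- The blocks $3-j$ and $j-1$ are reflections of each other, so both terms of the product rule
  -- carry the same factor $e^{v_j-v_{j-1}}$.
  have e2 : Complex.exp (logV l u (some (3 - j)) w) = expNeg l u (some (j - 1)) w := by
    rw [show (3 - j : ZMod (2 * l)) = 2 - (j - 1) by ring, logV_two_sub u w hl hj, expNeg]
    simp
  have e3 : expNeg l u (some (2 - j)) w = Complex.exp (logV l u (some j) w) := by
    rw [expNeg, logV_two_sub u w hl hj1]
    simp
  rw [e1, e2, dualBlockSum_of_ne hj, dualBlockSum_of_ne hj'', e3]
  field_simp

lemma hasWirtinger_conj_potentialDzbar (hl : 3 ≤ l) (hU : IsOpen U) (hu : IsTodaSolution l U u)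
    (hh : IsLaxSolution l U u μ h) (hμ : μ ≠ 0) (hw : w ∈ U) {j : ZMod (2 * l)}
    (hj1 : j ≠ 1) (hj2 : j ≠ 2) :
    ∃ r, HasWirtinger (fun x => (starRingEnd ℂ) (potentialDzbar μ u h j x)) r
      (-(altSign j * (Complex.exp (logV l u (some j) w) * expNeg l u (some (j - 1)) w *
        ((starRingEnd ℂ) (h w (some (2 - j))) * (starRingEnd ℂ) (h w (some j)) +
          (starRingEnd ℂ) (h w (some (3 - j))) * (starRingEnd ℂ) (h w (some (j - 1))))))) w := by
  have hj : j - 1 ≠ 1 := fun e => hj2 (by linear_combination e)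
  have hj' : 3 - j ≠ 1 := fun e => hj2 (by linear_combination -e)
  have hj'' : 2 - j ≠ 1 := fun e => hj1 (by linear_combination -e)
  have hν : (starRingEnd ℂ) μ ≠ 0 := (map_ne_zero _).mpr hμ
  have := ((hasWirtinger_conj_dual_entry hl hU hu hh hw (some (2 - j))).mul
    (hasWirtinger_conj_dual_entry hl hU hu hh hw (some (j - 1)))).const_mul
      (-(((starRingEnd ℂ) μ)⁻¹ * altSign j))
  refine ⟨_, (this.congr_deriv rfl ?_).congr_of_eventuallyEq
    (Filter.Eventually.of_forall fun x => by
      rw [potentialDzbar, dualBlockSum_of_ne hj'', dualBlockSum_of_ne hj]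
      simp only [map_mul, map_neg, map_inv₀, conj_altSign])⟩
  simp only [block, sub_add_cancel]
  have e1 : (2 - j + 1 : ZMod (2 * l)) = 3 - j := by ring
  have e3 : expNeg l u (some (2 - j)) w = Complex.exp (logV l u (some j) w) := by
    rw [expNeg, logV_two_sub u w hl hj1]
    simp
  rw [e1, blockSum_of_ne hj', blockSum_of_ne hj1, e3]
  simp only [map_mul, conj_expNeg, conj_exp_logV]
  field_simp
  ring

/-- The bilinear equation for `g_j`, away from the block of size `2`. -/
lemma tau_bilinear (hl : 3 ≤ l) (hU : IsOpen U) (hu : IsTodaSolution l U u)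
    (hh : IsLaxSolution l U u μ h) (hμ : μ ≠ 0) (hμ1 : ‖μ‖ ≠ 1) (hw : w ∈ U)
    (hs : ∑ c, pairing h c w = 0) {j : ZMod (2 * l)} (hj1 : j ≠ 1) (hj2 : j ≠ 2) :
    ∃ r s, HasWirtinger (tauDz μ u h j) r s w ∧
      s * tau μ u h j w - tauDz μ u h j w * tauDzbar μ u h j w =
        Complex.exp (logV l u (some j) w) * expNeg l u (some (j - 1)) w *
          (tau μ u h j w ^ 2 - tau μ u h (j + 1) w * tau μ u h (j - 1) w) := by
  have hj : j - 1 ≠ 1 := fun e => hj2 (by linear_combination e)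
  have hj' : 3 - j ≠ 1 := fun e => hj2 (by linear_combination -e)
  have hj'2 : 3 - j ≠ 2 := fun e => hj1 (by linear_combination -e)
  have hj'' : 2 - j ≠ 1 := fun e => hj1 (by linear_combination -e)
  have hν : (starRingEnd ℂ) μ ≠ 0 := (map_ne_zero _).mpr hμ
  have ha := hasWirtinger_potential hl hU hu hh hw j
  have hg := fun k => hasWirtinger_gram hl hU hu hh hμ hμ1 hw k
  obtain ⟨r1, h1⟩ := hasWirtinger_gramDz hl hU hu hh hμ hw hj1 hj2
  obtain ⟨r2, h2⟩ := hasWirtinger_gramDz hl hU hu hh hμ hw hj' hj'2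
  obtain ⟨r3, h3⟩ := hasWirtinger_potentialDz hl hU hu hh hμ hw hj1 hj2
  obtain ⟨r4, h4⟩ := hasWirtinger_conj_potentialDzbar hl hU hu hh hμ hw hj1 hj2
  refine ⟨_, _, ((h3.mul ha.star).add (ha.mul h4)).sub
    (((h1.mul (hg (3 - j))).add ((hg j).mul h2)).const_mul (μ * (starRingEnd ℂ) μ)), ?_⟩
  have e1 : (3 - j - 1 : ZMod (2 * l)) = 2 - j := by ring
  have e2 : Complex.exp (logV l u (some (3 - j)) w) = expNeg l u (some (j - 1)) w := by
    rw [show (3 - j : ZMod (2 * l)) = 2 - (j - 1) by ring, logV_two_sub u w hl hj, expNeg]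
    simp
  have e3 : expNeg l u (some (2 - j)) w = Complex.exp (logV l u (some j) w) := by
    rw [expNeg, logV_two_sub u w hl hj1]
    simp
  have d1 := density_eq_gram_add (u := u) (h := h) hl hμ1 j w
  have d2 := density_eq_gram_add (u := u) (h := h) hl hμ1 (j - 1) w
  have d3 := density_eq_gram_add (u := u) (h := h) hl hμ1 (3 - j) w
  have d4 := density_eq_gram_add (u := u) (h := h) hl hμ1 (2 - j) w
  rw [density_of_ne hj1] at d1
  rw [density_of_ne hj, sub_add_cancel] at d2
  rw [density_of_ne hj', show (3 - j + 1 : ZMod (2 * l)) = 4 - j by ring] at d3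
  rw [density_of_ne hj'', e3, show (2 - j + 1 : ZMod (2 * l)) = 3 - j by ring] at d4
  have p1 : potential h (j + 1) w =
      potential h j w + altSign j * (h w (some (2 - j)) * h w (some j)) := by
    rw [potential_succ hl hs, pairing, if_neg hj1]
  have p2 : potential h (j - 1) w =
      potential h j w + altSign j * (h w (some (3 - j)) * h w (some (j - 1))) := by
    have := potential_succ hl hs (j - 1)
    rw [sub_add_cancel, pairing, if_neg hj, altSign_sub_one,
      show (2 - (j - 1) : ZMod (2 * l)) = 3 - j by ring] at this
    linear_combination -this
  -- In this instance `P` and `Q` are $e^{-v_j}$ and $e^{-v_{j-1}}$, while `x`, `y`, `x₁`, `y₁` are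
  -- the entries of $h$ in the blocks $j$, $j-1$, $3-j$, $2-j$.
  have key := bilinear_identity hμ hν (altSign_mul_self j) (exp_mul_expNeg (u := u) (some j) w)
    (Qi := expNeg l u (some (3 - j)) w) (by rw [← e2, mul_comm, exp_mul_expNeg])
    (potential h j w) ((starRingEnd ℂ) (potential h j w)) _ _ _ _ _ _ _ _ _ _ _ _ _ _
    d1 d2 d3 d4
  simp only [tau, tauDz, tauDzbar, gramDz, potentialDz, potentialDzbar, e1, e2, p1, p2,
    blockSum_of_ne hj1, blockSum_of_ne hj', dualBlockSum_of_ne hj, dualBlockSum_of_ne hj'',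
    density_of_ne hj1, density_of_ne hj, density_of_ne hj', density_of_ne hj'', e3, map_mul,
    map_add, map_neg, map_inv₀, conj_altSign, conj_expNeg, conj_exp_logV, Complex.conj_conj,
    show (3 - (j + 1) : ZMod (2 * l)) = 2 - j by ring,
    show (3 - (j - 1) : ZMod (2 * l)) = 4 - j by ring]
  linear_combination key

lemma tau_three_sub (hl : 3 ≤ l) (hs : ∑ c, pairing h c w = 0) (j : ZMod (2 * l)) :
    tau μ u h (3 - j) w = tau μ u h j w := by
  rw [tau, tau, potential_three_sub hl hs, sub_sub_cancel, map_neg]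
  ring

omit [NeZero l] in
/-- The data of the block of size `2` do not depend on the order of its entries. -/
lemma edge_block (hl : 3 ≤ l) {α β : Index l}
    (hαβ : (α = some 1 ∧ β = none) ∨ (α = none ∧ β = some 1)) (w : ℂ) :
    block α = 1 ∧ block β = 1 ∧ expNeg l u α w * expNeg l u β w = 1 ∧
      Complex.exp (logV l u β w) = expNeg l u α w ∧
      blockSum h 1 w = h w α + h w β ∧
      dualBlockSum u h 1 w = expNeg l u α w * h w α + expNeg l u β w * h w β ∧
      density u h 1 w = expNeg l u α w * ((starRingEnd ℂ) (h w α) * h w α)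
        + expNeg l u β w * ((starRingEnd ℂ) (h w β) * h w β) ∧
      pairing h 1 w = 2 * (h w α * h w β) := by
  have e : logV l u none w = -logV l u (some 1) w := by
    rw [logV_some_one u w hl]; rfl
  have e2 : expNeg l u (some 1) w * expNeg l u none w = 1 := by
    rw [expNeg, expNeg, e, ← Complex.exp_add]; simp
  rcases hαβ with ⟨rfl, rfl⟩ | ⟨rfl, rfl⟩
  · refine ⟨rfl, rfl, e2, ?_, ?_, ?_, ?_, ?_⟩
    · rw [e, expNeg]; simp
    all_goals simp [blockSum, dualBlockSum, density, pairing]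
  · refine ⟨rfl, rfl, by rw [mul_comm, e2], ?_, ?_, ?_, ?_, ?_⟩
    · rw [expNeg, e]; simp
    all_goals simp [blockSum, dualBlockSum, density, pairing, add_comm, mul_comm]

omit [NeZero l] in
lemma two_ne_one (hl : 3 ≤ l) : (2 : ZMod (2 * l)) ≠ 1 := by
  have := natCast_ne_natCast (l := l) (a := 2) (b := 1) (by omega) (by omega) (by omega)
  exact_mod_cast this

omit [NeZero l] in
lemma zero_ne_one_zmod (hl : 3 ≤ l) : (0 : ZMod (2 * l)) ≠ 1 := by
  have := natCast_ne_natCast (l := l) (a := 0) (b := 1) (by omega) (by omega) (by omega)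
  exact_mod_cast this

/-- Subtracting $\gamma_1$ cancels the coupling of $h_\alpha$ to block $0$ and leaves, with the
opposite sign, that of the other entry $h_\beta$. -/
lemma hasWirtinger_edge (hl : 3 ≤ l) (hU : IsOpen U) (hu : IsTodaSolution l U u)
    (hh : IsLaxSolution l U u μ h) (hμ : μ ≠ 0) (hμ1 : ‖μ‖ ≠ 1) (hw : w ∈ U) {α β : Index l}
    (hαβ : (α = some 1 ∧ β = none) ∨ (α = none ∧ β = some 1)) :
    HasWirtinger (edge μ u h α) (edgeDz μ u h α β w)
      ((starRingEnd ℂ) (edgeDz μ u h α β w)) w := by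
  obtain ⟨b1, -, -, -, b5, -, -, -⟩ := edge_block (u := u) (h := h) hl hαβ w
  refine ((hasWirtinger_density_entry hl hU hu hh hw α).sub
    (hasWirtinger_gram hl hU hu hh hμ hμ1 hw 1)).congr_deriv ?_ ?_
  · rw [b1, one_add_one_eq_two, sub_self, gramDz, sub_self, edgeDz, b5,
      blockSum_of_ne (two_ne_one hl), dualBlockSum_of_ne (zero_ne_one_zmod hl)]
    simp only [map_mul, conj_expNeg]
    ring
  · rw [b1, one_add_one_eq_two, sub_self, gramDz, sub_self, edgeDz, b5,
      blockSum_of_ne (two_ne_one hl), dualBlockSum_of_ne (zero_ne_one_zmod hl)]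
    simp only [map_mul, map_add, map_sub, map_inv₀, conj_expNeg, Complex.conj_conj]
    ring

/-- Antisymmetry gives $a_1=-a_2$, and $a_2-a_1$ is the pairing $2h_{11}h_{12}$. -/
lemma potential_two (hl : 3 ≤ l) (hs : ∑ c, pairing h c w = 0) :
    potential h 2 w = h w (some 1) * h w none := by
  have h1 := potential_succ hl hs 1
  have h2 := potential_three_sub hl hs 1
  rw [one_add_one_eq_two] at h1
  rw [show (3 - 1 : ZMod (2 * l)) = 2 by ring] at h2
  rw [pairing, if_pos rfl] at h1
  linear_combination (1 / 2 : ℂ) * h1 + (1 / 2 : ℂ) * h2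

/-- `g_2` is the product of the two edge functions. -/
lemma tau_two (hl : 3 ≤ l) (hμ1 : ‖μ‖ ≠ 1) (hs : ∑ c, pairing h c w = 0) :
    tau μ u h 2 w = edge μ u h (some 1) w * edge μ u h none w := by
  obtain ⟨-, -, b3, -, -, -, b7, -⟩ := edge_block (u := u) (h := h) hl
    (α := some 1) (β := none) (Or.inl ⟨rfl, rfl⟩) w
  have d1 := density_eq_gram_add (u := u) (h := h) hl hμ1 1 w
  rw [b7, one_add_one_eq_two] at d1
  rw [tau, edge, edge, potential_two hl hs, map_mul, show (3 - 2 : ZMod (2 * l)) = 1 by ring]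
  -- With $D_1=\Gamma_1+|\mu|^2\Gamma_2$ the product of the edges is
  -- $|h_{11}h_{12}|^2-\Gamma_1D_1+\Gamma_1^2=|a_2|^2-|\mu|^2\Gamma_1\Gamma_2$.
  linear_combination (gram μ u h 1 w) * d1 - (starRingEnd ℂ) (h w (some 1)) * h w (some 1) *
    ((starRingEnd ℂ) (h w none) * h w none) * b3

/-- The bilinear equations at the block of size `2`. -/
lemma edge_bilinear (hl : 3 ≤ l) (hU : IsOpen U) (hu : IsTodaSolution l U u)
    (hh : IsLaxSolution l U u μ h) (hμ : μ ≠ 0) (hμ1 : ‖μ‖ ≠ 1) (hw : w ∈ U)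
    (hs : ∑ c, pairing h c w = 0) {α β : Index l}
    (hαβ : (α = some 1 ∧ β = none) ∨ (α = none ∧ β = some 1)) :
    ∃ r s, HasWirtinger (edgeDz μ u h α β) r s w ∧
      s * edge μ u h α w - edgeDz μ u h α β w * (starRingEnd ℂ) (edgeDz μ u h α β w) =
        expNeg l u (some 0) w * expNeg l u α w *
          (edge μ u h α w ^ 2 - tau μ u h 3 w) := by
  obtain ⟨b1, b2, b3, b4, b5, b6, b7, b8⟩ := edge_block (u := u) (h := h) hl hαβ w
  have hν : (starRingEnd ℂ) μ ≠ 0 := (map_ne_zero _).mpr hμ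
  have hen := fun γ => hasWirtinger_entry hl hU hu hh hw γ
  have hde := fun γ => hasWirtinger_conj_dual_entry hl hU hu hh hw γ
  refine ⟨_, _, (((hde α).mul (hen (some 2))).const_mul μ).sub
    (((hde (some 0)).mul (hen β)).const_mul ((starRingEnd ℂ) μ)⁻¹), ?_⟩
  have hv : Complex.exp (logV l u (some 2) w) = expNeg l u (some 0) w := by
    have := logV_two_sub u w hl (two_ne_one hl)
    rw [sub_self] at this
    rw [expNeg, this]; simp
  have d1 := density_eq_gram_add (u := u) (h := h) hl hμ1 1 w
  have d2 := density_eq_gram_add (u := u) (h := h) hl hμ1 2 w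
  have d0 := density_eq_gram_add (u := u) (h := h) hl hμ1 0 w
  rw [b7, one_add_one_eq_two] at d1
  rw [density_of_ne (two_ne_one hl), show (2 + 1 : ZMod (2 * l)) = 3 by ring] at d2
  rw [density_of_ne (zero_ne_one_zmod hl), zero_add] at d0
  have key := bilinear_identity_edge hμ hν b3
    (Qi := expNeg l u (some 2) w) (by rw [← hv, exp_mul_expNeg]) _ _ _ _ _ _ _ _ _ _ _ _ d1 d2 d0
  -- This quantity is symmetric in the two entries of block 1, so both edge functions lead to the
  -- same $\tau_3$.
  have p3 : potential h 3 w = h w α * h w β - h w (some 0) * h w (some 2) := by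
    have h1 := potential_succ hl hs 2
    have h2 : altSign (2 : ZMod (2 * l)) = -1 := by
      rw [← one_add_one_eq_two, altSign_add_one, altSign_one]
    have h3 : pairing h 1 w = 2 * (h w (some 1) * h w none) := by rw [pairing, if_pos rfl]
    rw [potential_two hl hs, pairing, if_neg (two_ne_one hl), h2, sub_self,
      show (2 + 1 : ZMod (2 * l)) = 3 by ring] at h1
    linear_combination h1 + (1 / 2 : ℂ) * b8 - (1 / 2 : ℂ) * h3
  have q1 : block (some (2 : ZMod (2 * l))) = 2 := rfl
  have q2 : block (some (0 : ZMod (2 * l))) = 0 := rfl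
  simp only [edge, edgeDz, tau, p3, b1, b2, b4, q1, q2, hv, one_add_one_eq_two, zero_add,
    show (2 - 1 : ZMod (2 * l)) = 1 by ring, sub_self, b5, b6,
    blockSum_of_ne (two_ne_one hl), dualBlockSum_of_ne (zero_ne_one_zmod hl), map_mul,
    map_add, map_sub, map_inv₀, conj_expNeg, Complex.conj_conj]
  linear_combination key

end

/-! ### Real forms, smoothness and the Laplacians of the logarithms -/

section
variable {l : ℕ} [NeZero l] {μ : ℂ} {u : ℕ → ℂ → ℝ} {h : ℂ → Index l → ℂ} {U : Set ℂ} {w : ℂ}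

omit [NeZero l] in
lemma density_term (α : Index l) (v : ℝ) (hv : logV l u α w = v) :
    expNeg l u α w * ((starRingEnd ℂ) (h w α) * h w α) =
      ((‖h w α‖ ^ 2 * Real.exp (-v) : ℝ) : ℂ) := by
  rw [expNeg, hv, mul_comm ((starRingEnd ℂ) _), Complex.mul_conj, Complex.normSq_eq_norm_sq]
  push_cast
  ring

/-- `γ_j` as a component of the solution of the cyclic recurrence. -/
lemma ofReal_gam (hl : 3 ≤ l) (j : ZMod (2 * l)) (w : ℂ) :
    ((gam l μ u h j w : ℝ) : ℂ) = gram μ u h (2 - j) w := by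
  have hm : μ * (starRingEnd ℂ) μ = ((‖μ‖ ^ 2 : ℝ) : ℂ) := by
    rw [Complex.mul_conj, Complex.normSq_eq_norm_sq]
  have hcast : ∀ c : ℕ, 2 ≤ c → c ≤ l → (c : ZMod (2 * l)) ≠ 1 := fun c h1 h2 => by
    have := natCast_ne_natCast (l := l) (a := c) (b := 1) (by omega) (by omega) (by omega)
    rwa [Nat.cast_one] at this
  have d1 : density u h 1 w = ((‖h w (some 1)‖ ^ 2 * Real.exp (-u 1 w) +
      ‖h w none‖ ^ 2 * Real.exp (u 1 w) : ℝ) : ℂ) := by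
    rw [density, if_pos rfl, density_term (some 1) (u 1 w) (logV_some_one u w hl),
      density_term none (-u 1 w) rfl, neg_neg]
    push_cast; ring
  have d2 : density u h ((l : ZMod (2 * l)) + 1) w =
      ((‖h w (some ((l : ZMod (2 * l)) + 1))‖ ^ 2 : ℝ) : ℂ) := by
    have e : (l : ZMod (2 * l)) + 1 ≠ 1 := by
      have := natCast_ne_natCast (l := l) (a := l + 1) (b := 1) (by omega) (by omega) (by omega)
      push_cast at this
      exact this
    rw [density_of_ne e, density_term _ 0 (logV_add_one u w hl)]
    simp
  have d3 : ∀ c ∈ Finset.Icc 2 l, density u h (c : ZMod (2 * l)) w =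
      ((‖h w (some (c : ZMod (2 * l)))‖ ^ 2 * Real.exp (-u c w) : ℝ) : ℂ) := fun c hc => by
    rw [Finset.mem_Icc] at hc
    rw [density_of_ne (hcast c hc.1 hc.2),
      density_term _ _ (logV_natCast u w (by omega) hc.2)]
  have d4 : ∀ c ∈ Finset.Icc 2 l, density u h (2 - (c : ZMod (2 * l))) w =
      ((‖h w (some (2 - (c : ZMod (2 * l))))‖ ^ 2 * Real.exp (u c w) : ℝ) : ℂ) := fun c hc => by
    rw [Finset.mem_Icc] at hc
    have e : 2 - (c : ZMod (2 * l)) ≠ 1 := fun e =>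
      hcast c hc.1 hc.2 (by linear_combination -e)
    rw [density_of_ne e, density_term _ _ (logV_two_sub_natCast u w hl hc.1 hc.2), neg_neg]
  have s3 : ∑ c ∈ Finset.Icc 2 l, (-(((‖μ‖ ^ 2 : ℝ) : ℂ))) ^ ((c : ZMod (2 * l)) - (2 - j)).val *
      density u h (c : ZMod (2 * l)) w = ∑ c ∈ Finset.Icc 2 l,
      (-(((‖μ‖ ^ 2 : ℝ) : ℂ))) ^ (j + (c : ZMod (2 * l)) - 2).val *
        ((‖h w (some (c : ZMod (2 * l)))‖ ^ 2 * Real.exp (-u c w) : ℝ) : ℂ) :=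
    Finset.sum_congr rfl fun c hc => by
      rw [d3 c hc, show ((c : ZMod (2 * l)) - (2 - j)) = j + c - 2 by ring]
  have s4 : ∑ c ∈ Finset.Icc 2 l,
      (-(((‖μ‖ ^ 2 : ℝ) : ℂ))) ^ (2 - (c : ZMod (2 * l)) - (2 - j)).val *
        density u h (2 - (c : ZMod (2 * l))) w = ∑ c ∈ Finset.Icc 2 l,
      (-(((‖μ‖ ^ 2 : ℝ) : ℂ))) ^ (j - (c : ZMod (2 * l))).val *
        ((‖h w (some (2 - (c : ZMod (2 * l))))‖ ^ 2 * Real.exp (u c w) : ℝ) : ℂ) :=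
    Finset.sum_congr rfl fun c hc => by
      rw [d4 c hc, show (2 - (c : ZMod (2 * l)) - (2 - j)) = j - c by ring]
  simp_rw [gram, mul_assoc]
  rw [← Finset.mul_sum, sum_zmod_eq_split hl, hm, d1, d2, s3, s4, gam,
    show (1 - (2 - j) : ZMod (2 * l)) = j - 1 by ring,
    show ((l : ZMod (2 * l)) + 1 - (2 - j)) = j + l - 1 by ring]
  push_cast
  rw [← pow_mul, show 2 * (2 * l) = 4 * l by ring, one_div]
  simp only [mul_assoc]

lemma ofReal_g (hl : 3 ≤ l) (j : ZMod (2 * l)) (w : ℂ) :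
    ((g l μ u h j w : ℝ) : ℂ) = tau μ u h j w := by
  have hp : potential h j w = (1 / (2 * l) : ℂ) *
      (2 * ((1 - j).val : ℂ) * h w (some 1) * h w none
        + ∑ c ∈ Finset.Icc 2 (2 * l), (-1 : ℂ) ^ (c + 1) * (((c : ZMod (2 * l)) - j).val : ℂ) *
            h w (some (2 - (c : ZMod (2 * l)))) * h w (some (c : ZMod (2 * l)))) := by
    simp_rw [potential, mul_assoc (1 / (2 * l) : ℂ)]
    rw [← Finset.mul_sum, sum_zmod_eq_one_add hl, pairing, if_pos rfl]
    congr 2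
    · ring
    · refine Finset.sum_congr rfl fun c hc => ?_
      rw [Finset.mem_Icc] at hc
      have e : (c : ZMod (2 * l)) ≠ 1 := by
        rcases hc.2.lt_or_eq with h2 | h2
        · have := natCast_ne_natCast (l := l) (a := c) (b := 1) h2 (by omega) (by omega)
          rwa [Nat.cast_one] at this
        · rw [h2, ZMod.natCast_self]; exact zero_ne_one_zmod hl
      rw [pairing, if_neg e, altSign_natCast]
      ring
  rw [tau, Complex.mul_conj, Complex.normSq_eq_norm_sq, Complex.mul_conj,
    Complex.normSq_eq_norm_sq, hp, norm_mul, g]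
  -- With $\Gamma_b=\gamma_{2-b}$, the product $\Gamma_j\Gamma_{3-j}$ is $\gamma_{2-j}\gamma_{j-1}$.
  have e1 := ofReal_gam (μ := μ) (u := u) (h := h) hl (j - 1) w
  have e2 := ofReal_gam (μ := μ) (u := u) (h := h) hl (2 - j) w
  rw [show (2 - (j - 1) : ZMod (2 * l)) = 3 - j by ring] at e1
  rw [sub_sub_cancel] at e2
  rw [← e1, ← e2]
  have e3 : ‖(1 / (2 * l) : ℂ)‖ = 1 / (2 * l) := by simp
  rw [e3]
  push_cast
  ring

/-- The real functions `|h_{11}|² e^{-u_1} - γ_1` and `|h_{12}|² e^{u_1} - γ_1`. -/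
noncomputable def edgeReal (l : ℕ) [NeZero l] (μ : ℂ) (u : ℕ → ℂ → ℝ) (h : ℂ → Index l → ℂ)
    (α : Index l) (w : ℂ) : ℝ :=
  ‖h w α‖ ^ 2 * Real.exp (-logV l u α w) - gam l μ u h 1 w

lemma ofReal_edgeReal (hl : 3 ≤ l) (α : Index l) (w : ℂ) :
    ((edgeReal l μ u h α w : ℝ) : ℂ) = edge μ u h α w := by
  rw [edge, density_term α _ rfl, edgeReal, Complex.ofReal_sub, ofReal_gam hl,
    show (2 - 1 : ZMod (2 * l)) = 1 by ring]

lemma contDiffOn_gram (hl : 3 ≤ l) (hU : IsOpen U) (hu : IsTodaSolution l U u)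
    (hh : IsLaxSolution l U u μ h) (b : ZMod (2 * l)) :
    ContDiffOn ℝ 2 (gram μ u h b) U := by
  have he : ∀ α, ContDiffOn ℝ 2
      (fun x => expNeg l u α x * ((starRingEnd ℂ) (h x α) * h x α)) U := fun α =>
    ((contDiffOn_ofReal (contDiffOn_logV hl hu α)).neg.cexp).mul
      ((contDiffOn_conj (contDiffOn_entry hl hU hu hh α)).mul (contDiffOn_entry hl hU hu hh α))
  unfold gram
  refine ContDiffOn.sum fun c _ => contDiffOn_const.mul ?_
  unfold density
  refine (he _).add ?_
  split_ifs
  · exact he none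
  · exact contDiffOn_const

lemma contDiffOn_re {n : WithTop ℕ∞} {f : ℂ → ℂ} {F : ℂ → ℝ} (hf : ContDiffOn ℝ n f U)
    (hF : ∀ x, (F x : ℂ) = f x) : ContDiffOn ℝ n F U :=
  (Complex.reCLM.contDiff.comp_contDiffOn hf).congr fun x _ => by
    simp [← hF]

lemma contDiffOn_g (hl : 3 ≤ l) (hU : IsOpen U) (hu : IsTodaSolution l U u)
    (hh : IsLaxSolution l U u μ h) (j : ZMod (2 * l)) : ContDiffOn ℝ 2 (g l μ u h j) U := by
  have hp : ContDiffOn ℝ 2 (potential h j) U := by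
    unfold potential
    refine ContDiffOn.sum fun c _ => contDiffOn_const.mul ?_
    unfold pairing
    split_ifs
    all_goals
      exact contDiffOn_const.mul
        ((contDiffOn_entry hl hU hu hh _).mul (contDiffOn_entry hl hU hu hh _))
  refine contDiffOn_re ?_ (ofReal_g hl j)
  exact (hp.mul (contDiffOn_conj hp)).sub (contDiffOn_const.mul
    ((contDiffOn_gram hl hU hu hh j).mul (contDiffOn_gram hl hU hu hh (3 - j))))

lemma contDiffOn_edgeReal (hl : 3 ≤ l) (hU : IsOpen U) (hu : IsTodaSolution l U u)
    (hh : IsLaxSolution l U u μ h) (α : Index l) : ContDiffOn ℝ 2 (edgeReal l μ u h α) U := by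
  refine contDiffOn_re ?_ (ofReal_edgeReal hl α)
  exact (((contDiffOn_ofReal (contDiffOn_logV hl hu α)).neg.cexp).mul
    ((contDiffOn_conj (contDiffOn_entry hl hU hu hh α)).mul
      (contDiffOn_entry hl hU hu hh α))).sub (contDiffOn_gram hl hU hu hh 1)

lemma laplacian_log_g (hl : 3 ≤ l) (hU : IsOpen U) (hu : IsTodaSolution l U u)
    (hh : IsLaxSolution l U u μ h) (hμ : μ ≠ 0) (hμ1 : ‖μ‖ ≠ 1)
    (hs : ∀ x ∈ U, ∑ c, pairing h c x = 0) (hw : w ∈ U) {j : ZMod (2 * l)}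
    (hj1 : j ≠ 1) (hj2 : j ≠ 2) (hg0 : ∀ x ∈ U, g l μ u h j x ≠ 0) :
    Laplacian.laplacian (fun x => Real.log (g l μ u h j x)) w =
      Real.exp (logV l u (some j) w - logV l u (some (j - 1)) w) *
        (1 - g l μ u h (j + 1) w * g l μ u h (j - 1) w / g l μ u h j w ^ 2) := by
  obtain ⟨r, s, h1, h2⟩ := tau_bilinear hl hU hu hh hμ hμ1 hw (hs w hw) hj1 hj2
  have h3 := laplacian_log hU hw (contDiffOn_g hl hU hu hh j) hg0
    (p := tauDz μ u h j) (q := tauDzbar μ u h j)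
    (fun x hx => (hasWirtinger_tau hl hU hu hh hμ hμ1 hx j).congr_of_eventuallyEq
      (Filter.Eventually.of_forall fun y => ofReal_g hl j y)) h1
  have h0 : (g l μ u h j w : ℂ) ≠ 0 := by exact_mod_cast hg0 w hw
  apply Complex.ofReal_injective
  rw [h3, ofReal_g hl, h2, expNeg, ← Complex.exp_add]
  rw [ofReal_g hl] at h0
  push_cast
  rw [ofReal_g hl, ofReal_g hl, ofReal_g hl, ← sub_eq_add_neg]
  field_simp

/-- Since $v_\alpha=\pm u_1$, the two choices of $\alpha$ produce $e^{u_2-u_1}$ and $e^{u_2+u_1}$.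
-/
lemma laplacian_log_edge (hl : 3 ≤ l) (hU : IsOpen U) (hu : IsTodaSolution l U u)
    (hh : IsLaxSolution l U u μ h) (hμ : μ ≠ 0) (hμ1 : ‖μ‖ ≠ 1)
    (hs : ∀ x ∈ U, ∑ c, pairing h c x = 0) (hw : w ∈ U) {α β : Index l}
    (hαβ : (α = some 1 ∧ β = none) ∨ (α = none ∧ β = some 1))
    (hA0 : ∀ x ∈ U, edgeReal l μ u h α x ≠ 0) :
    Laplacian.laplacian (fun x => Real.log (edgeReal l μ u h α x)) w =
      Real.exp (u 2 w - logV l u α w) *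
        (1 - g l μ u h 3 w / edgeReal l μ u h α w ^ 2) := by
  obtain ⟨r, s, h1, h2⟩ := edge_bilinear hl hU hu hh hμ hμ1 hw (hs w hw) hαβ
  have h3 := laplacian_log hU hw (contDiffOn_edgeReal hl hU hu hh α) hA0
    (p := edgeDz μ u h α β) (q := fun x => (starRingEnd ℂ) (edgeDz μ u h α β x))
    (fun x hx => (hasWirtinger_edge hl hU hu hh hμ hμ1 hx hαβ).congr_of_eventuallyEq
      (Filter.Eventually.of_forall fun y => ofReal_edgeReal hl α y)) h1
  have h0 : (edgeReal l μ u h α w : ℂ) ≠ 0 := by exact_mod_cast hA0 w hw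
  have hv : logV l u (some 0) w = -u 2 w := by simp [logV]
  apply Complex.ofReal_injective
  rw [h3, ofReal_edgeReal hl, h2, expNeg, expNeg, ← Complex.exp_add, hv]
  rw [ofReal_edgeReal hl] at h0
  push_cast
  rw [ofReal_g hl, ofReal_edgeReal hl, neg_neg, ← sub_eq_add_neg]
  field_simp

lemma laplacian_add_log_sub_log (hU : IsOpen U) (hw : w ∈ U) {f F G₁ G₂ : ℂ → ℝ}
    (hf : ContDiffOn ℝ 2 f U) (h1 : ContDiffOn ℝ 2 G₁ U) (h2 : ContDiffOn ℝ 2 G₂ U)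
    (h10 : ∀ x ∈ U, G₁ x ≠ 0) (h20 : ∀ x ∈ U, G₂ x ≠ 0)
    (hF : ∀ x ∈ U, F x = f x + Real.log (G₁ x / G₂ x)) :
    ContDiffOn ℝ 2 F U ∧ Laplacian.laplacian F w = Laplacian.laplacian f w +
      (Laplacian.laplacian (fun x => Real.log (G₁ x)) w -
        Laplacian.laplacian (fun x => Real.log (G₂ x)) w) := by
  -- The real logarithm is $\ln|\cdot|$, so no signs of $G_1$ and $G_2$ are needed, only that they
  -- do not vanish.
  have hF' : ∀ x ∈ U, F x = f x + (Real.log (G₁ x) - Real.log (G₂ x)) := fun x hx => by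
    rw [hF x hx, Real.log_div (h10 x hx) (h20 x hx)]
  have c1 := h1.log h10
  have c2 := h2.log h20
  have hn := hU.mem_nhds hw
  refine ⟨(hf.add (c1.sub c2)).congr hF', ?_⟩
  have e : F =ᶠ[nhds w] f + ((fun x => Real.log (G₁ x)) - fun x => Real.log (G₂ x)) := by
    filter_upwards [hn] with x hx
    simp [hF' x hx]
  rw [(InnerProductSpace.laplacian_congr_nhds e).eq_of_nhds,
    (hf.contDiffAt hn).laplacian_add (f₂ := (fun x => Real.log (G₁ x)) - fun x => Real.log (G₂ x))
      ((c1.sub c2).contDiffAt hn),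
    (c1.contDiffAt hn).laplacian_sub (c2.contDiffAt hn)]

end

/-! ### The Toda equations for the transformed functions -/

section
variable {l : ℕ} [NeZero l] {μ : ℂ} {u : ℕ → ℂ → ℝ} {h : ℂ → Index l → ℂ} {U : Set ℂ} {w : ℂ}

lemma factor_one (hl : 3 ≤ l) (w : ℂ) :
    factor l μ u h 1 w = edgeReal l μ u h (some 1) w / edgeReal l μ u h none w := by
  rw [factor, if_pos rfl, edgeReal, edgeReal, logV_some_one u w hl, logV, neg_neg]

omit [NeZero l] in
lemma factor_of_two_le {j : ℕ} (hj : 2 ≤ j) (w : ℂ) :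
    factor l μ u h j w =
      g l μ u h ((j + 1 : ℕ) : ZMod (2 * l)) w / g l μ u h (j : ZMod (2 * l)) w := by
  rw [factor, if_neg (by omega)]
  push_cast
  rfl

lemma g_two (hl : 3 ≤ l) (hμ1 : ‖μ‖ ≠ 1) (hs : ∑ c, pairing h c w = 0) :
    g l μ u h ((2 : ℕ) : ZMod (2 * l)) w =
      edgeReal l μ u h (some 1) w * edgeReal l μ u h none w := by
  apply Complex.ofReal_injective
  push_cast
  rw [ofReal_g hl, tau_two hl hμ1 hs, ofReal_edgeReal hl, ofReal_edgeReal hl]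

lemma g_three_sub (hl : 3 ≤ l) (hs : ∑ c, pairing h c w = 0) (j : ZMod (2 * l)) :
    g l μ u h (3 - j) w = g l μ u h j w := by
  apply Complex.ofReal_injective
  rw [ofReal_g hl, ofReal_g hl, tau_three_sub hl hs]

omit [NeZero l] in
lemma exp_newU {j : ℕ} (hp : 0 < factor l μ u h j w) :
    Real.exp (newU l μ u h j w) = Real.exp (u j w) * factor l μ u h j w := by
  rw [newU, Real.exp_add, Real.exp_log hp]

lemma laplacian_log_g_natCast (hl : 3 ≤ l) (hU : IsOpen U) (hu : IsTodaSolution l U u)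
    (hh : IsLaxSolution l U u μ h) (hμ : μ ≠ 0) (hμ1 : ‖μ‖ ≠ 1)
    (hs : ∀ x ∈ U, ∑ c, pairing h c x = 0) (hw : w ∈ U) {j : ℕ} (h3 : 3 ≤ j) (hj : j ≤ l + 1)
    (hg0 : ∀ x ∈ U, g l μ u h (j : ZMod (2 * l)) x ≠ 0) :
    Laplacian.laplacian (fun x => Real.log (g l μ u h (j : ZMod (2 * l)) x)) w =
      Real.exp (logV l u (some (j : ZMod (2 * l))) w - u (j - 1) w) *
        (1 - g l μ u h ((j + 1 : ℕ) : ZMod (2 * l)) w *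
          g l μ u h ((j - 1 : ℕ) : ZMod (2 * l)) w / g l μ u h (j : ZMod (2 * l)) w ^ 2) := by
  have h1 : (j : ZMod (2 * l)) ≠ 1 := by
    have := natCast_ne_natCast (l := l) (a := j) (b := 1) (by omega) (by omega) (by omega)
    rwa [Nat.cast_one] at this
  have h2 : (j : ZMod (2 * l)) ≠ 2 := by
    have := natCast_ne_natCast (l := l) (a := j) (b := 2) (by omega) (by omega) (by omega)
    rwa [Nat.cast_two] at this
  have e : (j : ZMod (2 * l)) - 1 = ((j - 1 : ℕ) : ZMod (2 * l)) := by
    rw [Nat.cast_sub (by omega), Nat.cast_one]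
  rw [laplacian_log_g hl hU hu hh hμ hμ1 hs hw h1 h2 hg0, e,
    logV_natCast u w (c := j - 1) (by omega) (by omega), Nat.cast_add, Nat.cast_one]

end

/-- The Darboux transformation maps solutions of the Toda equation to solutions. -/
theorem isTodaSolution_newU (l : ℕ) [NeZero l] (hl : 3 ≤ l)
    (U : Set ℂ) (hU : IsOpen U)
    (u : ℕ → ℂ → ℝ) (hu : IsTodaSolution l U u)
    (μ : ℂ) (hμ0 : μ ≠ 0) (hμ1 : ‖μ‖ ≠ 1)
    (h : ℂ → Index l → ℂ) (hh : IsLaxSolution l U u μ h)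
    (hconstr : ∀ w ∈ U,
      2 * h w (some 1) * h w none + (-1 : ℂ) ^ l * h w (some ((l : ZMod (2 * l)) + 1)) ^ 2
        + 2 * ∑ c ∈ Finset.Icc 2 l, (-1 : ℂ) ^ (c - 1) *
            h w (some (c : ZMod (2 * l))) * h w (some (2 - (c : ZMod (2 * l)))) = 0)
    (hpos : ∀ w ∈ U, ∀ j, 1 ≤ j → j ≤ l → 0 < factor l μ u h j w) :
    IsTodaSolution l U (newU l μ u h) := by
  have hs : ∀ x ∈ U, ∑ c, pairing h c x = 0 := fun x hx => sum_pairing hl (hconstr x hx)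
  set A := edgeReal l μ u h (some 1) with hA
  set B := edgeReal l μ u h none with hB
  have hAB : ∀ x ∈ U, A x ≠ 0 ∧ B x ≠ 0 := fun x hx => by
    have := hpos x hx 1 le_rfl (by omega)
    rw [factor_one hl] at this
    -- Division by zero has value $0$, so positivity of the quotient forces a non-zero numerator and
    -- denominator.
    exact div_ne_zero_iff.mp this.ne'
  have hA0 := fun x hx => (hAB x hx).1
  have hB0 := fun x hx => (hAB x hx).2
  let G : ℕ → ℂ → ℝ := fun j => g l μ u h (j : ZMod (2 * l))
  have hG : ∀ j, 2 ≤ j → j ≤ l → ∀ x ∈ U, G (j + 1) x ≠ 0 ∧ G j x ≠ 0 :=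
    fun j h2 hj x hx => by
      have := hpos x hx j (by omega) hj
      rw [factor_of_two_le h2] at this
      exact div_ne_zero_iff.mp this.ne'
  have hG0 : ∀ j, 2 ≤ j → j ≤ l + 1 → ∀ x ∈ U, G j x ≠ 0 := fun j h2 hj x hx => by
    rcases hj.lt_or_eq with h1 | h1
    · exact (hG j h2 (by omega) x hx).2
    -- The index $l+1$ occurs only as the numerator of the last factor.
    · subst h1; exact (hG l (by omega) le_rfl x hx).1
  have hGc : ∀ j, ContDiffOn ℝ 2 (G j) U := fun j => contDiffOn_g hl hU hu hh _
  have hAc : ContDiffOn ℝ 2 A U := contDiffOn_edgeReal hl hU hu hh _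
  have hBc : ContDiffOn ℝ 2 B U := contDiffOn_edgeReal hl hU hu hh _
  have hf1 : ∀ x, factor l μ u h 1 x = A x / B x := factor_one hl
  have hf : ∀ j, 2 ≤ j → ∀ x, factor l μ u h j x = G (j + 1) x / G j x :=
    fun j hj x => factor_of_two_le hj x
  have hN1 := fun w (hw : w ∈ U) => laplacian_add_log_sub_log hU hw
    (hu.contDiffOn 1 le_rfl (by omega)) hAc hBc hA0 hB0 (F := newU l μ u h 1)
    (fun x _ => by rw [newU, hf1])
  have hN := fun j (h2 : 2 ≤ j) (hj : j ≤ l) w (hw : w ∈ U) => laplacian_add_log_sub_log hU hw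
    (hu.contDiffOn j (by omega) hj) (hGc (j + 1)) (hGc j) (hG0 (j + 1) (by omega) (by omega))
    (hG0 j h2 (by omega)) (F := newU l μ u h j) (fun x _ => by rw [newU, hf j h2])
  have hLA := fun w (hw : w ∈ U) =>
    laplacian_log_edge hl hU hu hh hμ0 hμ1 hs hw (Or.inl ⟨rfl, rfl⟩) hA0
  have hLB := fun w (hw : w ∈ U) =>
    laplacian_log_edge hl hU hu hh hμ0 hμ1 hs hw (Or.inr ⟨rfl, rfl⟩) hB0
  have hLG := fun j (h3 : 3 ≤ j) (hj : j ≤ l + 1) w (hw : w ∈ U) =>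
    laplacian_log_g_natCast hl hU hu hh hμ0 hμ1 hs hw h3 hj (hG0 j (by omega) hj)
  have hg3 : ∀ x, g l μ u h 3 x = G 3 x := fun x => by simp [G]
  have hv1 : ∀ x, logV l u (some 1) x = u 1 x := fun x => logV_some_one u x hl
  have hv2 : ∀ x, logV l u none x = -u 1 x := fun x => rfl
  have hexp := fun w (hw : w ∈ U) j h1 hj => exp_newU (hpos w hw j h1 hj)
  have hG2 : ∀ x ∈ U, G 2 x = A x * B x := fun x hx => g_two hl hμ1 (hs x hx)
  refine ⟨?_, ?_, ?_, ?_, ?_⟩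
  · intro j h1 hj w hw
    rcases h1.eq_or_lt with rfl | h2
    · exact (hN1 w hw).1 w hw
    · exact (hN j h2 hj w hw).1 w hw
  · intro w hw
    have a0 := hA0 w hw
    have b0 := hB0 w hw
    rw [(hN1 w hw).2, hu.eq_one w hw, hLA w hw, hLB w hw]
    simp only [Real.exp_add, Real.exp_sub, hexp w hw 1 le_rfl (by omega),
      hexp w hw 2 (by omega) (by omega), hf1, hf 2 le_rfl, hG2 w hw, hg3, hv1, hv2, Real.exp_neg,
      ← hA, ← hB]
    norm_num
    field_simp
    ring
  · intro w hw
    have a0 := hA0 w hw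
    have b0 := hB0 w hw
    have g30 := hG0 3 (by omega) (by omega) w hw
    -- The bilinear equation for $\tau_j$ excludes $j=2$; the factorisation $g_2=AB$ supplies both
    -- exponentials $e^{u_2\pm u_1}$ instead.
    have hlog2 : Laplacian.laplacian (fun x => Real.log (G 2 x)) w =
        Laplacian.laplacian (fun x => Real.log (A x)) w +
          Laplacian.laplacian (fun x => Real.log (B x)) w := by
      have e : (fun x => Real.log (G 2 x)) =ᶠ[nhds w]
          (fun x => Real.log (A x)) + fun x => Real.log (B x) := by
        filter_upwards [hU.mem_nhds hw] with x hx
        simp [hG2 x hx, Real.log_mul (hA0 x hx) (hB0 x hx)]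
      rw [(InnerProductSpace.laplacian_congr_nhds e).eq_of_nhds,
        ((hAc.log hA0).contDiffAt (hU.mem_nhds hw)).laplacian_add
          ((hBc.log hB0).contDiffAt (hU.mem_nhds hw))]
    have h3 := hLG 3 le_rfl (by omega) w hw
    rw [logV_natCast u w (by omega) hl] at h3
    rw [(hN 2 le_rfl (by omega) w hw).2, hu.eq_two w hw, hlog2, hLA w hw, hLB w hw, h3]
    simp only [Real.exp_add, Real.exp_sub, hv1, hv2, Real.exp_neg, hg3,
      hexp w hw 1 le_rfl (by omega), hexp w hw 2 (by omega) (by omega),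
      hexp w hw 3 (by omega) (by omega), hf1, hf 2 le_rfl, hf 3 (by omega)]
    change _ + (_ * (1 - G 4 w * G 2 w / G 3 w ^ 2) - _) = _
    rw [hG2 w hw]
    simp only [← hA, ← hB]
    norm_num
    field_simp
    ring
  · intro j h3 hj w hw
    have g0 := hG0 (j - 1) (by omega) (by omega) w hw
    have g1 := hG0 j (by omega) (by omega) w hw
    have g2 := hG0 (j + 1) (by omega) (by omega) w hw
    have k1 := hLG j (by omega) (by omega) w hw
    have k2 := hLG (j + 1) (by omega) (by omega) w hw
    rw [logV_natCast u w (by omega) (by omega)] at k1 k2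
    rw [(hN j (by omega) (by omega) w hw).2, hu.eq_mid j h3 hj w hw, k1, k2]
    have hfj := hf (j - 1) (by omega) w
    rw [Nat.sub_add_cancel (by omega)] at hfj
    simp only [Real.exp_sub, hexp w hw (j - 1) (by omega) (by omega),
      hexp w hw j (by omega) (by omega), hexp w hw (j + 1) (by omega) (by omega),
      hfj, hf j (by omega), hf (j + 1) (by omega), Nat.add_sub_cancel]
    change _ + (_ * (1 - G (j + 1 + 1) w * G j w / G (j + 1) w ^ 2) -
      _ * (1 - G (j + 1) w * G (j - 1) w / G j w ^ 2)) = _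
    field_simp
    ring
  · intro w hw
    have g0 := hG0 (l - 1) (by omega) (by omega) w hw
    have g1 := hG0 l (by omega) (by omega) w hw
    have g2 := hG0 (l + 1) (by omega) (by omega) w hw
    have k1 := hLG l (by omega) (by omega) w hw
    have k2 := hLG (l + 1) (by omega) (by omega) w hw
    -- Modulo $2l$ one has $3-(l+1)=2-l\equiv l+2$, so the reflection symmetry closes the chain at
    -- this end.
    have hsym : g l μ u h ((l + 1 + 1 : ℕ) : ZMod (2 * l)) w = G (l + 1) w := by
      have e : ((l + 1 + 1 : ℕ) : ZMod (2 * l)) = 3 - ((l + 1 : ℕ) : ZMod (2 * l)) := by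
        have := ZMod.natCast_self (2 * l)
        push_cast at this ⊢
        linear_combination this
      rw [e, g_three_sub hl (hs w hw)]
    rw [logV_natCast u w (by omega) (by omega)] at k1
    -- The vanishing of $v_{l+1}$ turns the exponent $v_{l+1}-u_l$ into the $-u_l$ of the last
    -- equation.
    rw [Nat.cast_add (l), Nat.cast_one, logV_add_one u w hl, ← Nat.cast_one (R := ZMod (2 * l)),
      ← Nat.cast_add, hsym, Nat.add_sub_cancel] at k2
    rw [(hN l (by omega) (by omega) w hw).2, hu.eq_last w hw, k1, k2]
    have hfj := hf (l - 1) (by omega) w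
    rw [Nat.sub_add_cancel (by omega)] at hfj
    simp only [Real.exp_sub, Real.exp_neg, Real.exp_zero,
      hexp w hw (l - 1) (by omega) (by omega),
      hexp w hw l (by omega) (by omega), hfj, hf l (by omega)]
    change _ + (_ * (1 - G (l + 1) w * G l w / G (l + 1) w ^ 2) -
      _ * (1 - G (l + 1) w * G (l - 1) w / G l w ^ 2)) = _
    field_simp
    ring

end EllipticToda

theorem mainTheorem9 (l : ℕ) [NeZero l] (hl : 3 ≤ l)
    (U : Set ℂ) (hU : IsOpen U)
    (u : ℕ → ℂ → ℝ) (hu : EllipticToda.IsTodaSolution l U u)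
    (μ : ℂ) (hμ0 : μ ≠ 0) (hμ1 : ‖μ‖ ≠ 1)
    (h : ℂ → EllipticToda.Index l → ℂ) (hh : EllipticToda.IsLaxSolution l U u μ h)
    (hconstr : ∀ w ∈ U,
      2 * h w (some 1) * h w none + (-1 : ℂ) ^ l * h w (some ((l : ZMod (2 * l)) + 1)) ^ 2
        + 2 * ∑ c ∈ Finset.Icc 2 l, (-1 : ℂ) ^ (c - 1) *
            h w (some (c : ZMod (2 * l))) * h w (some (2 - (c : ZMod (2 * l)))) = 0)
    (hpos : ∀ w ∈ U, ∀ j, 1 ≤ j → j ≤ l → 0 < EllipticToda.factor l μ u h j w) :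
    EllipticToda.IsTodaSolution l U (EllipticToda.newU l μ u h) :=
  EllipticToda.isTodaSolution_newU l hl U hU u hu μ hμ0 hμ1 h hh hconstr hpos
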